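/- Let $G$ be a finite solvable group. Let ${\rm Irr}_m(G)$ be the set of irreducible complex characters of $G$ that are monomial, i.e. induced from a character of degree one of some subgroup of $G$, and let $\mathbf{F}(G)$ be the Fitting subgroup of $G$, i.e. its largest nilpotent normal subgroup. Suppose that $G/\mathbf{F}(G)$ is supersolvable, i.e. that it has a finite series, from the trivial subgroup to the whole group, of normal subgroups of $G/\mathbf{F}(G)$ with cyclic successive quotients. Then every monomial-non-vanishing element of $G$ lies in $\mathbf{F}(G)$; that is, if $g\in G$ satisfies $\chi(g)\neq 0$ for every $\chi\in{\rm Irr}_m(G)$, then $g\in\mathbf{F}(G)$. -/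

import Mathlib

/-- The Fitting subgroup of `G`: the subgroup generated by all nilpotent normal subgroups
(for a finite group it is the largest nilpotent normal subgroup). -/
def fittingSubgroup (G : Type*) [Group G] : Subgroup G :=
  sSup {N : Subgroup G | N.Normal ∧ Group.IsNilpotent N}

instance fittingSubgroup_normal (G : Type*) [Group G] : (fittingSubgroup G).Normal :=
  Subgroup.sSup_normal _ fun _ hN => hN.1

/-- `G` is supersolvable: there is a finite series `⊥ = H 0 ≤ H 1 ≤ ⋯ ≤ H n = ⊤` of subgroups
normal in `G` all of whose factors `H (i + 1) / H i` are cyclic. -/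
def IsSupersolvable (G : Type*) [Group G] : Prop :=
  ∃ (n : ℕ) (H : ℕ → Subgroup G) (_ : ∀ i, (H i).Normal),
    H 0 = ⊥ ∧ H n = ⊤ ∧
      ∀ i < n, H i ≤ H (i + 1) ∧ IsCyclic (H (i + 1) ⧸ (H i).subgroupOf (H (i + 1)))

/-- `Irr(G)`: the set of irreducible complex characters of `G`. -/
def irreducibleCharacters (G : Type*) [Group G] : Set (G → ℂ) :=
  {χ | ∃ (n : ℕ) (ρ : Representation ℂ G (Fin n → ℂ)), ρ.IsIrreducible ∧ χ = ρ.character}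

/-- `χ` is a monomial character of `G`: it is afforded by the representation induced from a
one-dimensional complex representation of some subgroup `H` of `G`. -/
def IsMonomialCharacter {G : Type*} [Group G] (χ : G → ℂ) : Prop :=
  ∃ (H : Subgroup G) (lam : Representation ℂ H ℂ),
    χ = (Representation.ind H.subtype lam).character

/-- `Irr_m(G)`: the set of irreducible monomial characters of `G`. -/
def irreducibleMonomialCharacters (G : Type*) [Group G] : Set (G → ℂ) :=
  {χ | χ ∈ irreducibleCharacters G ∧ IsMonomialCharacter χ}

/-- `g` is monomial-non-vanishing: no irreducible monomial character of `G` vanishes at `g`. -/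
def IsMonomialNonVanishing {G : Type*} [Group G] (g : G) : Prop :=
  ∀ χ ∈ irreducibleMonomialCharacters G, χ g ≠ 0

/-! Write F for the Fitting subgroup and let g be monomial-non-vanishing. Since G is solvable, g
lies in F once it centralizes every chief factor F/D
(`mem_fittingSubgroup_of_centralizes_isChiefFactor`). Fix one, and let G act by conjugation on V,
the group of linear characters of F trivial on D.

Supersolvability of G/F supplies monomial characters: an irreducible representation on which F acts
by commuting operators is monomial (`Representation.IsIrreducible.isMonomialCharacter_of_series`).
This is used twice. First, for M ≥ F, if a coset gK of a nontrivial normal subgroup K of G/M lay in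
the class of g, an irreducible character of G/M nontrivial on K would vanish at g. Going down a
series with cyclic factors, this forces the conjugates of g to commute modulo F
(`IsMonomialNonVanishing.commute_conj_quotient`), hence to act on V by commuting automorphisms.
Second, an irreducible character over u in V would vanish at g if no conjugate of g fixed u
(`Representation.IsIrreducible.character_eq_zero_of_weight`).

Commutation allows a choice of u so generic that every conjugate of g fixing u fixes pointwise a
nontrivial G-invariant J ≤ V (`exists_fixing_imp_fixing_subgroup`). By invariance of J, g itself
fixes J pointwise, so [F, g] lies in the annihilator of J in F, which is D because F/D is chief. -/

/-! ### Fitting's theorem -/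

open Subgroup commutatorElement in
/-- A nontrivial normal subgroup contained in a nilpotent subgroup `M` contains nontrivial
elements centralizing `M`. -/
theorem inf_centralizer_ne_bot_of_le_nilpotent {G : Type*} [Group G] {B M : Subgroup G} [B.Normal]
    (hBM : B ≤ M) (hM : Group.IsNilpotent M) (hB : B ≠ ⊥) :
    B ⊓ centralizer (M : Set G) ≠ ⊥ := by
  classical
  obtain ⟨n, hn⟩ := (Group.isNilpotent_iff M).1 hM
  -- Take b as low as possible in the upper central series of M: its commutators with M stay in B
  -- and drop one level, so they are trivial.
  have hex : ∃ n, ∃ b : M, (b : G) ∈ B ∧ b ≠ 1 ∧ b ∈ Subgroup.upperCentralSeries M n := by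
    obtain ⟨b, hb, hb1⟩ := B.bot_or_exists_ne_one.resolve_left hB
    exact ⟨n, ⟨b, hBM hb⟩, hb, fun h => hb1 (congrArg Subtype.val h), by rw [hn]; trivial⟩
  obtain ⟨b, hb, hb1, hbn⟩ := Nat.find_spec hex
  intro hbot
  have hmem : (b : G) ∈ B ⊓ centralizer (M : Set G) := by
    refine ⟨hb, mem_centralizer_iff.2 fun m hm => ?_⟩
    rcases hk : Nat.find hex with _ | k
    · rw [hk] at hbn
      exact absurd (by simpa using hbn) hb1
    · rw [hk] at hbn
      have h1 : ⁅b, (⟨m, hm⟩ : M)⁆ ∈ Subgroup.upperCentralSeries M k := hbn ⟨m, hm⟩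
      have h2 : ((⁅b, (⟨m, hm⟩ : M)⁆ : M) : G) ∈ B := by
        have : ((⁅b, (⟨m, hm⟩ : M)⁆ : M) : G) = b * (m * (b : G)⁻¹ * m⁻¹) := by
          simp [commutatorElement_def, mul_assoc]
        rw [this]
        exact B.mul_mem hb (Normal.conj_mem inferInstance _ (B.inv_mem hb) m)
      have h3 : ⁅b, (⟨m, hm⟩ : M)⁆ = 1 := by
        by_contra hne
        exact Nat.find_min hex (m := k) (by omega) ⟨_, h2, hne, h1⟩
      have h4 := commutatorElement_eq_one_iff_mul_comm.1 h3
      exact (congrArg Subtype.val h4).symm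
  rw [hbot] at hmem
  exact hb1 (Subtype.ext (by simpa using hmem))

-- Induction on the order, passing to G/Z(G). The centre is nontrivial: Z(N) ≠ 1 either meets M
-- trivially, and then commutes with M, or meets M in a normal subgroup, which has nontrivial
-- elements centralizing M.
open Subgroup commutatorElement in
theorem isNilpotent_of_normal_sup_eq_top (n : ℕ) : ∀ {G : Type*} [Group G] [Finite G]
    (N M : Subgroup G) [N.Normal] [M.Normal], Nat.card G = n → Group.IsNilpotent N →
    Group.IsNilpotent M → N ⊔ M = ⊤ → Group.IsNilpotent G := by
  induction n using Nat.strong_induction_on with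
  | _ n ih =>
  intro G _ _ N M _ _ hn hN hM htop
  by_cases hN0 : N = ⊥
  · have : M = ⊤ := by simpa [hN0] using htop
    subst this
    exact Group.nilpotent_of_mulEquiv (Subgroup.topEquiv (G := G))
  have hcenter : ∀ z : G, z ∈ centralizer (N : Set G) → z ∈ centralizer (M : Set G) →
      z ∈ center G := by
    intro z h1 h2
    have : (⊤ : Subgroup G) ≤ centralizer {z} := by
      rw [← htop, sup_le_iff]
      constructor
      · intro x hx
        exact mem_centralizer_singleton_iff.2 ((mem_centralizer_iff.1 h1) x hx)
      · intro x hx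
        exact mem_centralizer_singleton_iff.2 ((mem_centralizer_iff.1 h2) x hx)
    exact mem_center_iff.2 fun x => mem_centralizer_singleton_iff.1 (this (mem_top x))
  have hZ : center G ≠ ⊥ := by
    have h1 := inf_centralizer_ne_bot_of_le_nilpotent le_rfl hN hN0
    by_cases h2 : (N ⊓ centralizer (N : Set G)) ⊓ M = ⊥
    · intro hb
      apply h1
      rw [eq_bot_iff, ← hb]
      intro z hz
      refine hcenter z hz.2 (mem_centralizer_iff.2 fun m hm => ?_)
      exact (commute_of_normal_of_disjoint _ M inferInstance inferInstance
        (disjoint_iff.2 h2) z m hz hm).symm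
    · have h3 := inf_centralizer_ne_bot_of_le_nilpotent inf_le_right hM h2
      intro hb
      apply h3
      rw [eq_bot_iff, ← hb]
      intro z hz
      exact hcenter z hz.1.1.2 hz.2
  apply Group.of_quotient_center_nilpotent
  have hcard : Nat.card (G ⧸ center G) < n := by
    have h1 := card_eq_card_quotient_mul_card_subgroup (center G)
    have h2 : 1 < Nat.card (center G) := (one_lt_card_iff_ne_bot _).2 hZ
    have h3 : 0 < Nat.card (G ⧸ center G) := Nat.card_pos
    nlinarith
  have hs := QuotientGroup.mk'_surjective (center G)
  have := Normal.map (H := N) inferInstance _ hs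
  have := Normal.map (H := M) inferInstance _ hs
  refine ih _ hcard (N.map (QuotientGroup.mk' _)) (M.map (QuotientGroup.mk' _)) rfl
    (Group.nilpotent_of_surjective _ ((QuotientGroup.mk' (center G)).subgroupMap_surjective N))
    (Group.nilpotent_of_surjective _ ((QuotientGroup.mk' (center G)).subgroupMap_surjective M)) ?_
  rw [← Subgroup.map_sup, htop, Subgroup.map_top_of_surjective _ hs]

open Subgroup commutatorElement in
/-- **Fitting's theorem**: the join of two nilpotent normal subgroups is nilpotent. -/
theorem isNilpotent_sup_of_normal {G : Type*} [Group G] [Finite G] {N M : Subgroup G} [N.Normal]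
    [M.Normal] (hN : Group.IsNilpotent N) (hM : Group.IsNilpotent M) :
    Group.IsNilpotent (N ⊔ M : Subgroup G) := by
  have h1 : Group.IsNilpotent (N.subgroupOf (N ⊔ M)) :=
    Group.nilpotent_of_mulEquiv (subgroupOfEquivOfLe (le_sup_left : N ≤ N ⊔ M)).symm
  have h2 : Group.IsNilpotent (M.subgroupOf (N ⊔ M)) :=
    Group.nilpotent_of_mulEquiv (subgroupOfEquivOfLe (le_sup_right : M ≤ N ⊔ M)).symm
  refine isNilpotent_of_normal_sup_eq_top _ (N.subgroupOf (N ⊔ M)) (M.subgroupOf (N ⊔ M)) rfl h1 h2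
    ?_
  rw [← subgroupOf_sup le_sup_left le_sup_right, subgroupOf_self]

theorem isNilpotent_fittingSubgroup (G : Type*) [Group G] [Finite G] :
    Group.IsNilpotent (fittingSubgroup G) := by
  have hfin : {N : Subgroup G | N.Normal ∧ Group.IsNilpotent N}.Finite := Set.toFinite _
  have key : ∀ S : Set (Subgroup G), S.Finite → S ⊆ {N | N.Normal ∧ Group.IsNilpotent N} →
      (sSup S).Normal ∧ Group.IsNilpotent (sSup S : Subgroup G) := by
    intro S hS
    induction S, hS using Set.Finite.induction_on with
    | empty =>
      intro _
      rw [sSup_empty]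
      exact ⟨inferInstance, inferInstance⟩
    | insert _ _ ih =>
      intro hsub
      obtain ⟨h1, h2⟩ := ih ((Set.subset_insert _ _).trans hsub)
      obtain ⟨h3, h4⟩ := hsub (Set.mem_insert _ _)
      rw [sSup_insert]
      exact ⟨inferInstance, isNilpotent_sup_of_normal h4 h2⟩
  exact (key _ hfin le_rfl).2

/-! ### Chief factors below the Fitting subgroup -/

/-- `F / D` is a chief factor of `G` (the bottom subgroup is named first). -/
def IsChiefFactor {G : Type*} [Group G] (D F : Subgroup G) : Prop :=
  D.Normal ∧ D < F ∧ ∀ E : Subgroup G, E.Normal → D ≤ E → E ≤ F → E = D ∨ E = F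

open Subgroup commutatorElement in
/-- If `F` is nilpotent and `M` is a maximal subgroup not containing `F`, then `F / (F ⊓ M)` is a
chief factor. -/
theorem isChiefFactor_inf_of_isCoatom {G : Type*} [Group G] [Finite G] {F M : Subgroup G}
    [F.Normal] (hF : Group.IsNilpotent F) (hM : IsCoatom M) (hFM : ¬ F ≤ M) :
    IsChiefFactor (F ⊓ M) F := by
  have htop : F ⊔ M = ⊤ := hM.2 _ (lt_of_le_of_ne le_sup_right fun h => hFM (h ▸ le_sup_left))
  have hlt : F ⊓ M < F := lt_of_le_of_ne inf_le_left fun h => hFM (inf_eq_left.1 h)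
  refine ⟨?_, hlt, fun E hE hDE hEF => ?_⟩
  -- M normalizes `F ⊓ M`. Normalizers grow in the nilpotent group F, so some element of F outside M
  -- does too; by maximality of M, all of G does.
  · have hMn : M ≤ normalizer ((F ⊓ M : Subgroup G) : Set G) := by
      intro m hm
      refine mem_normalizer_iff.2 fun x => ?_
      constructor
      · rintro ⟨h1, h2⟩
        exact ⟨Normal.conj_mem inferInstance _ h1 m,
          M.mul_mem (M.mul_mem hm h2) (M.inv_mem hm)⟩
      · rintro ⟨h1, h2⟩
        have e : x = m⁻¹ * (m * x * m⁻¹) * m⁻¹⁻¹ := by group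
        rw [e]
        exact ⟨Normal.conj_mem inferInstance _ h1 m⁻¹,
          M.mul_mem (M.mul_mem (M.inv_mem hm) h2) (M.inv_mem (M.inv_mem hm))⟩
    have hnc := Group.normalizerCondition_of_isNilpotent (G := F) ((F ⊓ M).subgroupOf F)
      (by
        rw [lt_top_iff_ne_top, Ne, subgroupOf_eq_top]
        exact not_le_of_gt hlt)
    obtain ⟨f, hf, hfn⟩ := SetLike.exists_of_lt hnc
    have hfM : (f : G) ∉ M := fun h => hfn (mem_subgroupOf.2 ⟨f.2, h⟩)
    have hfN : (f : G) ∈ normalizer ((F ⊓ M : Subgroup G) : Set G) := by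
      refine mem_normalizer_iff.2 fun x => ?_
      have h := mem_normalizer_iff.1 hf
      constructor
      · intro hx
        have := (h ⟨x, hx.1⟩).1 (mem_subgroupOf.2 hx)
        exact mem_subgroupOf.1 this
      · intro hx
        have hxF : x ∈ F := by
          have e : x = (f : G)⁻¹ * (f * x * (f : G)⁻¹) * (f : G) := by group
          rw [e]
          exact F.mul_mem (F.mul_mem (F.inv_mem f.2) hx.1) f.2
        have := (h ⟨x, hxF⟩).2 (mem_subgroupOf.2 hx)
        exact mem_subgroupOf.1 this
    have : normalizer ((F ⊓ M : Subgroup G) : Set G) = ⊤ :=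
      hM.2 _ (lt_of_le_of_ne hMn fun h => hfM (h ▸ hfN))
    exact normalizer_eq_top_iff.1 this
  · have hEM : E ≤ M ∨ E ⊔ M = ⊤ := by
      by_cases h : E ≤ M
      · exact Or.inl h
      · exact Or.inr (hM.2 _ (lt_of_le_of_ne le_sup_right fun h' => h (h' ▸ le_sup_left)))
    rcases hEM with h | h
    · exact Or.inl (le_antisymm (le_inf hEF h) hDE)
    · refine Or.inr (le_antisymm hEF fun f hf => ?_)
      obtain ⟨e, he, m, hm, rfl⟩ := mem_sup_of_normal_left.1 (h ▸ mem_top f : f ∈ E ⊔ M)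
      have : m ∈ F := (F.mul_mem_cancel_left (hEF he)).1 hf
      exact E.mul_mem he (hDE ⟨this, hm⟩)

open Subgroup commutatorElement in
/-- A normal subgroup `Q ≥ F`, `F` normal nilpotent, with `Q / F` abelian and centralizing all
chief factors `F / D` is nilpotent. -/
theorem isNilpotent_of_centralizes_isChiefFactor {G : Type*} [Group G] [Finite G]
    {F Q : Subgroup G} [F.Normal] [Q.Normal] (hF : Group.IsNilpotent F) (hFQ : F ≤ Q)
    (hQ : ⁅Q, Q⁆ ≤ F) (hc : ∀ D, IsChiefFactor D F → ⁅F, Q⁆ ≤ D) : Group.IsNilpotent Q := by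
  -- It suffices that Sylow subgroups P of Q are normal. Otherwise N_G(P) lies in a maximal M; once
  -- `Q ⊓ M` is known to be normal, the Frattini argument gives G = N_G(P)(Q ∩ M) ≤ M.
  refine (Group.isNilpotent_of_finite_tfae (G := Q)).out 3 0 rfl rfl |>.1 ?_
  intro p hp P
  suffices h : normalizer ((P : Subgroup Q).map Q.subtype : Set G) = ⊤ by
    have := normalizer_eq_top_iff.1 h
    have h2 := this.comap Q.subtype
    rwa [comap_map_eq_self_of_injective Q.subtype_injective] at h2
  by_contra hne
  obtain ⟨M, hM, hNM⟩ := (eq_top_or_exists_le_coatom _).resolve_left hne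
  have hPM : (P : Subgroup Q).map Q.subtype ≤ M := le_normalizer.trans hNM
  have hPQ : (P : Subgroup Q).map Q.subtype ≤ Q := map_subtype_le _
  have hMn : M ≤ normalizer ((Q ⊓ M : Subgroup G) : Set G) := by
    intro m hm
    refine mem_normalizer_iff.2 fun x => ?_
    constructor
    · rintro ⟨h1, h2⟩
      exact ⟨Normal.conj_mem inferInstance _ h1 m, M.mul_mem (M.mul_mem hm h2) (M.inv_mem hm)⟩
    · rintro ⟨h1, h2⟩
      have e : x = m⁻¹ * (m * x * m⁻¹) * m⁻¹⁻¹ := by group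
      rw [e]
      exact ⟨Normal.conj_mem inferInstance _ h1 m⁻¹,
        M.mul_mem (M.mul_mem (M.inv_mem hm) h2) (M.inv_mem (M.inv_mem hm))⟩
  have hnormalizes : ∀ R : Subgroup G, ⁅R, Q⁆ ≤ Q ⊓ M →
      R ≤ normalizer ((Q ⊓ M : Subgroup G) : Set G) := by
    intro R hR
    have hone : ∀ r ∈ R, ∀ x ∈ Q ⊓ M, r * x * r⁻¹ ∈ Q ⊓ M := by
      intro r hr x hx
      have h := mul_mem (hR (commutator_mem_commutator hr hx.1)) hx
      rwa [commutatorElement_def, inv_mul_cancel_right] at h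
    intro r hr
    refine mem_normalizer_iff.2 fun x => ⟨hone r hr x, fun h => ?_⟩
    have e : x = r⁻¹ * (r * x * r⁻¹) * r⁻¹⁻¹ := by group
    rw [e]
    exact hone _ (R.inv_mem hr) _ h
  -- If M misses part of Q but contains F, then G = QM and [Q, Q] ≤ F ≤ M. If M does not contain F,
  -- then G = FM, and `hc` applies to the chief factor F/(F ∩ M).
  have hnormal : (Q ⊓ M).Normal := by
    by_cases hFM : F ≤ M
    · by_cases hQM : Q ≤ M
      · rw [inf_eq_left.2 hQM]; infer_instance
      · have htop : Q ⊔ M = ⊤ :=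
          hM.2 _ (lt_of_le_of_ne le_sup_right fun h => hQM (h ▸ le_sup_left))
        refine normalizer_eq_top_iff.1 (top_le_iff.1 ?_)
        rw [← htop]
        exact sup_le (hnormalizes Q (hQ.trans (le_inf hFQ hFM))) hMn
    · have htop : F ⊔ M = ⊤ :=
        hM.2 _ (lt_of_le_of_ne le_sup_right fun h => hFM (h ▸ le_sup_left))
      refine normalizer_eq_top_iff.1 (top_le_iff.1 ?_)
      rw [← htop]
      exact sup_le (hnormalizes F ((hc _ (isChiefFactor_inf_of_isCoatom hF hM hFM)).trans
        (inf_le_inf_right M hFQ))) hMn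
  have hle : (P : Subgroup Q).map Q.subtype ≤ Q ⊓ M := le_inf hPQ hPM
  have hindex : ¬ p ∣ (((P : Subgroup Q).map Q.subtype).subgroupOf (Q ⊓ M)).index := by
    intro hdvd
    have h1 := relIndex_mul_relIndex _ _ _ hle (inf_le_left : Q ⊓ M ≤ Q)
    have h2 : ((P : Subgroup Q).map Q.subtype).relIndex Q = (P : Subgroup Q).index := by
      rw [relIndex, subgroupOf, comap_map_eq_self_of_injective Q.subtype_injective]
    exact P.not_dvd_index (h2 ▸ h1 ▸ dvd_mul_of_dvd_left hdvd _)
  have h2 := Sylow.normalizer_sup_eq_top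
    (IsPGroup.toSylow ((P.2.map Q.subtype).comap_of_injective (Q ⊓ M).subtype
      (Q ⊓ M).subtype_injective) hindex)
  have h3 : (((P : Subgroup Q).map Q.subtype).comap (Q ⊓ M).subtype).map (Q ⊓ M).subtype
      = (P : Subgroup Q).map Q.subtype := by
    rw [← subgroupOf, subgroupOf_map_subtype, inf_eq_left.2 hle]
  change normalizer (((((P : Subgroup Q).map Q.subtype).comap (Q ⊓ M).subtype).map
    (Q ⊓ M).subtype : Subgroup G) : Set G) ⊔ _ = _ at h2
  rw [h3] at h2
  exact hM.1 (top_le_iff.1 (h2 ▸ sup_le hNM inf_le_right))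

open Subgroup commutatorElement in
/-- A chief factor `F / D` of a finite solvable group is abelian. -/
theorem IsChiefFactor.commutator_le {G : Type*} [Group G] [Group.IsSolvable G]
    {D F : Subgroup G} [F.Normal] (h : IsChiefFactor D F) : ⁅F, F⁆ ≤ D := by
  obtain ⟨hD, hlt, hE⟩ := h
  have hle : ⁅F, F⁆ ≤ F := commutator_le_left F F
  rcases hE (D ⊔ ⁅F, F⁆) inferInstance le_sup_left (sup_le hlt.le hle) with h | h
  · exact h ▸ le_sup_right
  -- F/D would be a nontrivial perfect subgroup of a solvable group.
  · exfalso
    have hne : F.map (QuotientGroup.mk' D) ≠ ⊥ := by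
      intro hb
      rw [(Subgroup.map_eq_bot_iff _), QuotientGroup.ker_mk'] at hb
      exact not_le_of_gt hlt hb
    have hlt' := Group.IsSolvable.commutator_lt_of_ne_bot hne
    refine hlt'.ne ?_
    conv_rhs => rw [← h, Subgroup.map_sup]
    rw [(Subgroup.map_eq_bot_iff D).2 (QuotientGroup.ker_mk' D).ge, bot_sup_eq, map_commutator]

open Subgroup commutatorElement in
/-- In a finite solvable group, an element centralizing all chief factors `F / D`, where `F` is the
Fitting subgroup, lies in `F`. -/
theorem mem_fittingSubgroup_of_centralizes_isChiefFactor {G : Type*} [Group G] [Finite G]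
    [Group.IsSolvable G] {g : G}
    (hg : ∀ D, IsChiefFactor D (fittingSubgroup G) → ∀ f ∈ fittingSubgroup G, ⁅f, g⁆ ∈ D) :
    g ∈ fittingSubgroup G := by
  set F := fittingSubgroup G with hFdef
  have hcent : ∀ D, IsChiefFactor D F → ∃ K : Subgroup G, K.Normal ∧ g ∈ K ∧ F ≤ K ∧
      ⁅F, K⁆ ≤ D := by
    intro D hD
    have := hD.1
    have hs := QuotientGroup.mk'_surjective D
    have := Normal.map (H := F) inferInstance _ hs
    have hmem : ∀ x : G, x ∈ (centralizer (F.map (QuotientGroup.mk' D) : Set (G ⧸ D))).comap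
        (QuotientGroup.mk' D) ↔ ∀ f ∈ F, ⁅f, x⁆ ∈ D := by
      intro x
      rw [mem_comap, mem_centralizer_iff_commutator_eq_one]
      constructor
      · intro h f hf
        have := h _ (mem_map_of_mem _ hf)
        rw [← map_commutatorElement] at this
        exact (QuotientGroup.eq_one_iff _).1 this
      · rintro h _ ⟨f, hf, rfl⟩
        rw [← map_commutatorElement]
        exact (QuotientGroup.eq_one_iff _).2 (h f hf)
    refine ⟨(centralizer (F.map (QuotientGroup.mk' D) : Set (G ⧸ D))).comap
        (QuotientGroup.mk' D), inferInstance, (hmem g).2 (hg D hD), fun x hx => ?_, ?_⟩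
    · exact (hmem x).2 fun f hf => hD.commutator_le (commutator_mem_commutator hf hx)
    · rw [commutator_le]
      exact fun f hf x hx => (hmem x).1 hx f hf
  have hclosure : ∀ D, IsChiefFactor D F → ⁅F, F ⊔ normalClosure {g}⁆ ≤ D := by
    intro D hD
    obtain ⟨K, hK, hgK, hFK, hle⟩ := hcent D hD
    exact (commutator_mono le_rfl (sup_le hFK (normalClosure_le_normal (by simpa using hgK)))).trans
      hle
  set K := F ⊔ normalClosure {g} with hK
  -- Climb the derived series from its trivial term: if K ∩ G⁽ⁿ⁺¹⁾ ≤ F, then F(K ∩ G⁽ⁿ⁾) is abelian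
  -- over F and centralizes the chief factors F/D, so it is nilpotent and normal, hence inside F.
  suffices h : ∀ n, K ⊓ derivedSeries G n ≤ F → K ≤ F by
    obtain ⟨n, hn⟩ := Group.IsSolvable.solvable (G := G)
    exact h n (by simp [hn]) (le_sup_right (a := F) (subset_normalClosure rfl))
  intro n
  induction n with
  | zero => simp
  | succ n ih =>
    intro h
    refine ih (le_sup_right.trans (?_ : F ⊔ K ⊓ derivedSeries G n ≤ F))
    refine le_sSup ⟨inferInstance, isNilpotent_of_centralizes_isChiefFactor
      (isNilpotent_fittingSubgroup G) le_sup_left ?_ fun D hD =>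
        (commutator_mono le_rfl (sup_le le_sup_left inf_le_left)).trans (hclosure D hD)⟩
    change _ ≤ F
    rw [← QuotientGroup.ker_mk' F, ← Subgroup.map_eq_bot_iff, map_commutator, Subgroup.map_sup,
      (Subgroup.map_eq_bot_iff _).2 le_rfl, bot_sup_eq, ← map_commutator,
      Subgroup.map_eq_bot_iff, QuotientGroup.ker_mk']
    refine le_trans (le_inf ?_ ?_) h
    · exact (commutator_mono inf_le_left inf_le_left).trans (commutator_le_left K K)
    · exact commutator_mono inf_le_right inf_le_right

/-! ### Generic points for commuting automorphisms -/

/-- If a conjugation-invariant set `E` of a group acting on a finite abelian group `U` consists of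
elements whose actions commute, then every nontrivial invariant subgroup `V` of `U` contains an
element `u` and a nontrivial invariant subgroup `J` such that every element of `E` fixing `u`
fixes `J` pointwise. -/
theorem exists_fixing_imp_fixing_subgroup {G U : Type*} [Group G] [CommGroup U] [Finite U]
    (φ : G →* MulAut U) (E : Set G) (hE : ∀ y, ∀ e ∈ E, y * e * y⁻¹ ∈ E)
    (hcomm : ∀ e ∈ E, ∀ e' ∈ E, ∀ u, φ e (φ e' u) = φ e' (φ e u)) (V : Subgroup U)
    (hV : ∀ g, ∀ v ∈ V, φ g v ∈ V) (hV1 : V ≠ ⊥) :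
    ∃ u ∈ V, ∃ J ≤ V, J ≠ ⊥ ∧ (∀ g, ∀ j ∈ J, φ g j ∈ J) ∧
      ∀ e ∈ E, φ e u = u → ∀ j ∈ J, φ e j = j := by
  have hmap : ∀ (g : G) (S : Subgroup U) (w : U), w ∈ S.map (φ g).toMonoidHom ↔ φ g⁻¹ w ∈ S := by
    intro g S w
    rw [Subgroup.mem_map_equiv, map_inv]
    rfl
  have hinv : ∀ (g : G) (w : U), φ g (φ g⁻¹ w) = w := by
    intro g w
    rw [← MulAut.mul_apply, ← map_mul, mul_inv_cancel, map_one, MulAut.one_apply]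
  -- a minimal `E`-invariant subgroup of `V`
  obtain ⟨S, hS⟩ := (Set.toFinite {S : Subgroup U | S ≠ ⊥ ∧ S ≤ V ∧
    ∀ e ∈ E, ∀ s ∈ S, φ e s ∈ S}).exists_minimal ⟨V, hV1, le_rfl, fun e _ => hV e⟩
  obtain ⟨⟨hS1, hSV, hSE⟩, hSmin⟩ := hS
  have hsimple : ∀ T : Subgroup U, (∀ e ∈ E, ∀ t ∈ T, φ e t ∈ T) → T ≤ S → T ≠ ⊥ → S ≤ T :=
    fun T hT hTS hT1 => hSmin ⟨hT1, hTS.trans hSV, hT⟩ hTS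
  -- an invariant subgroup that is maximal among those with a generic element
  obtain ⟨T, hT⟩ := (Set.toFinite {T : Subgroup U | T ≤ V ∧ (∀ e ∈ E, ∀ t ∈ T, φ e t ∈ T) ∧
    ∃ u ∈ T, ∀ e ∈ E, φ e u = u → ∀ t ∈ T, φ e t = t}).exists_maximal
      ⟨⊥, bot_le, by simp, 1, by simp⟩
  obtain ⟨⟨hTV, hTE, u, huT, hu⟩, hTmax⟩ := hT
  have hST : ∀ y, S.map (φ y).toMonoidHom ≤ T := by
    intro y
    set S' := S.map (φ y).toMonoidHom with hS'
    have hmem : ∀ w, w ∈ S' ↔ φ y⁻¹ w ∈ S := hmap y S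
    have hconj : ∀ (e : G) (w : U), φ y⁻¹ (φ e w) = φ (y⁻¹ * e * y⁻¹⁻¹) (φ y⁻¹ w) := by
      intro e w
      rw [← MulAut.mul_apply, ← MulAut.mul_apply, ← map_mul, ← map_mul]
      congr 2
      group
    have hS'E : ∀ e ∈ E, ∀ s ∈ S', φ e s ∈ S' := by
      intro e he s hs
      rw [hmem, hconj]
      exact hSE _ (hE _ _ he) _ ((hmem s).1 hs)
    have hS'V : S' ≤ V := by
      intro w hw
      have := hV y _ (hSV ((hmem w).1 hw))
      rwa [hinv] at this
    have hsimple' : ∀ R : Subgroup U, (∀ e ∈ E, ∀ r ∈ R, φ e r ∈ R) → R ≤ S' → R ≠ ⊥ →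
        S' ≤ R := by
      intro R hR hRS hR1
      have h1 : S ≤ R.map (φ y⁻¹).toMonoidHom := by
        refine hsimple _ ?_ ?_ ?_
        · intro e he w hw
          rw [hmap, inv_inv] at hw ⊢
          have : φ y (φ e w) = φ (y * e * y⁻¹) (φ y w) := by
            rw [← MulAut.mul_apply, ← MulAut.mul_apply, ← map_mul, ← map_mul]
            congr 2
            group
          rw [this]
          exact hR _ (hE _ _ he) _ hw
        · intro w hw
          rw [hmap, inv_inv] at hw
          have h2 := (hmem _).1 (hRS hw)
          have h3 := hinv y⁻¹ w
          rw [inv_inv] at h3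
          rwa [h3] at h2
        · rwa [Ne, Subgroup.map_eq_bot_iff_of_injective _ (φ y⁻¹).injective]
      intro w hw
      have h2 := h1 ((hmem w).1 hw)
      rwa [hmap, inv_inv, hinv] at h2
    -- Otherwise the minimal invariant S' meets T trivially, and u * s is generic for `T ⊔ S'` for
    -- any nontrivial s in S', contradicting maximality: an e fixing u * s must fix u and s
    -- separately.
    by_contra hnot
    have hdisj : S' ⊓ T = ⊥ := by
      by_contra h
      exact hnot ((hsimple' (S' ⊓ T) (fun e he r hr => ⟨hS'E e he r hr.1, hTE e he r hr.2⟩)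
        inf_le_left h).trans inf_le_right)
    have hS'1 : S' ≠ ⊥ := fun h => hnot (h ▸ bot_le)
    obtain ⟨s, hs, hs1⟩ := S'.bot_or_exists_ne_one.resolve_left hS'1
    refine hnot (le_sup_right.trans (hTmax (y := T ⊔ S') ⟨sup_le hTV hS'V, ?_, u * s,
      Subgroup.mul_mem_sup huT hs, ?_⟩ le_sup_left))
    · intro e he t ht
      obtain ⟨a, ha, b, hb, rfl⟩ := Subgroup.mem_sup.1 ht
      rw [map_mul]
      exact Subgroup.mul_mem_sup (hTE e he a ha) (hS'E e he b hb)
    · intro e he hfix t ht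
      rw [map_mul] at hfix
      have h1 : φ e s * s⁻¹ = (φ e u)⁻¹ * u := by
        rw [mul_inv_eq_iff_eq_mul, mul_assoc, ← hfix, inv_mul_cancel_left]
      have h2 : φ e s * s⁻¹ ∈ S' ⊓ T :=
        ⟨S'.mul_mem (hS'E e he s hs) (S'.inv_mem hs),
          h1 ▸ T.mul_mem (T.inv_mem (hTE e he u huT)) huT⟩
      rw [hdisj, Subgroup.mem_bot] at h2
      have hus : φ e u = u := by rw [h2] at h1; exact inv_mul_eq_one.1 h1.symm
      have hss : φ e s = s := mul_inv_eq_one.1 h2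
      have hfixS : ∀ w ∈ S', φ e w = w := by
        -- The fixed points of e in S' form an E-invariant subgroup, because E acts commutatively;
        -- it contains s, so minimality makes it all of S'.
        have hle : S' ≤ S' ⊓ (MonoidHom.eqLocus (φ e).toMonoidHom (MonoidHom.id U)) := by
          refine hsimple' _ ?_ inf_le_left ?_
          · rintro e' he' r ⟨hr1, hr2⟩
            refine ⟨hS'E e' he' r hr1, ?_⟩
            change φ e (φ e' r) = φ e' r
            rw [hcomm e he e' he', show φ e r = r from hr2]
          · intro hb
            have hmem' : s ∈ S' ⊓ (MonoidHom.eqLocus (φ e).toMonoidHom (MonoidHom.id U)) :=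
              ⟨hs, hss⟩
            rw [hb] at hmem'
            exact hs1 hmem'
        exact fun w hw => (hle hw).2
      obtain ⟨a, ha, b, hb, rfl⟩ := Subgroup.mem_sup.1 ht
      rw [map_mul, hu e he hus a ha, hfixS b hb]
  refine ⟨u, hTV huT, ⨆ y, S.map (φ y).toMonoidHom, iSup_le fun y => (hST y).trans hTV, ?_, ?_, ?_⟩
  · intro h
    have : S.map (φ 1).toMonoidHom ≤ ⊥ := h ▸ le_iSup (fun y => S.map (φ y).toMonoidHom) 1
    rw [le_bot_iff, Subgroup.map_eq_bot_iff_of_injective _ (φ 1).injective] at this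
    exact hS1 this
  · intro g j hj
    have hle : (⨆ y, S.map (φ y).toMonoidHom) ≤
        (⨆ y, S.map (φ y).toMonoidHom).comap (φ g).toMonoidHom := by
      refine iSup_le fun y w hw => ?_
      refine Subgroup.mem_comap.2 (le_iSup (fun y => S.map (φ y).toMonoidHom) (g * y) ?_)
      change φ g w ∈ _
      rw [hmap] at hw ⊢
      rw [← MulAut.mul_apply, ← map_mul, mul_inv_rev, inv_mul_cancel_right]
      exact hw
    exact hle hj
  · intro e he hfix j hj
    exact hu e he hfix j (iSup_le hST hj)

/-! ### Existence and vanishing for irreducible representations -/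

namespace Representation

variable {G V : Type*} [Group G] [AddCommGroup V] [Module ℂ V]

theorem isIrreducible_iff_forall_submodule (ρ : Representation ℂ G V) :
    ρ.IsIrreducible ↔ Nontrivial V ∧ ∀ W : Submodule ℂ V, (∀ g, ∀ w ∈ W, ρ g w ∈ W) →
      W = ⊥ ∨ W = ⊤ := by
  constructor
  · intro h
    constructor
    · by_contra hV
      rw [not_nontrivial_iff_subsingleton] at hV
      refine bot_ne_top (α := Subrepresentation ρ) (Subrepresentation.toSubmodule_injective ?_)
      exact Subsingleton.elim _ _
    · intro W hW
      rcases h.eq_bot_or_eq_top ⟨W, fun g w hw => hW g w hw⟩ with h | h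
      · exact Or.inl (congrArg Subrepresentation.toSubmodule h)
      · exact Or.inr (congrArg Subrepresentation.toSubmodule h)
  · rintro ⟨hV, h⟩
    exact
      { exists_pair_ne := ⟨⊥, ⊤, fun hb => bot_ne_top (α := Submodule ℂ V)
          (congrArg Subrepresentation.toSubmodule hb)⟩
        eq_bot_or_eq_top := fun W => (h W.toSubmodule fun g w hw =>
          W.apply_mem_toSubmodule g hw).imp (fun h => Subrepresentation.toSubmodule_injective h)
          fun h => Subrepresentation.toSubmodule_injective h }

/-- The transport of a representation along a linear equivalence. -/
noncomputable def transport {W : Type*} [AddCommGroup W] [Module ℂ W] (ρ : Representation ℂ G V)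
    (e : V ≃ₗ[ℂ] W) : Representation ℂ G W :=
  (e.conjAlgEquiv ℂ : Module.End ℂ V →* Module.End ℂ W).comp ρ

theorem transport_apply {W : Type*} [AddCommGroup W] [Module ℂ W] (ρ : Representation ℂ G V)
    (e : V ≃ₗ[ℂ] W) (g : G) (w : W) : ρ.transport e g w = e (ρ g (e.symm w)) := rfl

theorem IsIrreducible.transport {W : Type*} [AddCommGroup W] [Module ℂ W]
    {ρ : Representation ℂ G V} (h : ρ.IsIrreducible) (e : V ≃ₗ[ℂ] W) :
    (ρ.transport e).IsIrreducible := by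
  rw [isIrreducible_iff_forall_submodule] at h ⊢
  obtain ⟨h1, h2⟩ := h
  refine ⟨e.symm.toEquiv.nontrivial, fun U hU => ?_⟩
  have := h2 (U.comap (e : V →ₗ[ℂ] W)) fun g w hw => by
    have := hU g _ hw
    rw [transport_apply] at this
    simpa using this
  rcases this with h | h
  · left
    rw [eq_bot_iff]
    intro w hw
    have : e.symm w ∈ U.comap (e : V →ₗ[ℂ] W) := by simpa using hw
    rw [h] at this
    simpa using this
  · right
    rw [eq_top_iff]
    intro w _
    have : e.symm w ∈ U.comap (e : V →ₗ[ℂ] W) := h ▸ Submodule.mem_top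
    simpa using this

/-- Every nonzero element of the group algebra acts nontrivially on some irreducible
representation. -/
theorem exists_isIrreducible_asAlgebraHom_ne_zero [Finite G] {r : MonoidAlgebra ℂ G}
    (hr : r ≠ 0) :
    ∃ (n : ℕ) (ρ : Representation ℂ G (Fin n → ℂ)), ρ.IsIrreducible ∧ ρ.asAlgebraHom r ≠ 0 := by
  -- By Maschke, 1 is a sum of elements of simple left ideals, so r cannot kill all of these.
  obtain ⟨S, hS, m, hm, hrm⟩ : ∃ S : Submodule (MonoidAlgebra ℂ G) (MonoidAlgebra ℂ G),
      IsSimpleModule (MonoidAlgebra ℂ G) S ∧ ∃ m ∈ S, r • m ≠ 0 := by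
    by_contra! hcon
    have htop := IsSemisimpleModule.sSup_simples_eq_top (MonoidAlgebra ℂ G) (MonoidAlgebra ℂ G)
    have h1 : (1 : MonoidAlgebra ℂ G) ∈
        sSup {S : Submodule (MonoidAlgebra ℂ G) (MonoidAlgebra ℂ G) |
          IsSimpleModule (MonoidAlgebra ℂ G) S} := htop ▸ Submodule.mem_top
    rw [sSup_eq_iSup'] at h1
    have h2 : r • (1 : MonoidAlgebra ℂ G) = 0 := by
      refine Submodule.iSup_induction _ (motive := fun m => r • m = 0) h1 ?_ (smul_zero _) ?_
      · rintro ⟨S, hS⟩ m hm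
        exact hcon S hS m hm
      · intro x y hx hy
        rw [smul_add, hx, hy, add_zero]
    exact hr (by simpa using h2)
  let S' : Submodule ℂ (MonoidAlgebra ℂ G) := S.restrictScalars ℂ
  let σ : Representation ℂ G S' :=
    { toFun := fun g => (LinearMap.mulLeft ℂ (MonoidAlgebra.of ℂ G g)).restrict
        fun s (hs : s ∈ S) => S.smul_mem (MonoidAlgebra.of ℂ G g) hs
      map_one' := by
        ext1 s
        exact Subtype.ext (by
          change MonoidAlgebra.of ℂ G 1 * (s : MonoidAlgebra ℂ G) = s
          rw [map_one, one_mul])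
      map_mul' := fun a b => by
        ext1 s
        exact Subtype.ext (by
          change MonoidAlgebra.of ℂ G (a * b) * (s : MonoidAlgebra ℂ G) =
            MonoidAlgebra.of ℂ G a * (MonoidAlgebra.of ℂ G b * (s : MonoidAlgebra ℂ G))
          rw [map_mul, mul_assoc]) }
  have hσr : ∀ (r : MonoidAlgebra ℂ G) (s : S'),
      (σ.asAlgebraHom r s : MonoidAlgebra ℂ G) = r * s := by
    intro r s
    induction r using MonoidAlgebra.induction_on with
    | of g => rw [asAlgebraHom_of]; rfl
    | add a b ha hb => rw [map_add, LinearMap.add_apply, Submodule.coe_add, ha, hb, add_mul]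
    | smul c a ha => rw [map_smul, LinearMap.smul_apply, Submodule.coe_smul, ha, smul_mul_assoc]
  have hatom : IsAtom S := isSimpleModule_iff_isAtom.1 hS
  have hσ : σ.IsIrreducible := by
    rw [isIrreducible_iff_forall_submodule]
    constructor
    · exact ⟨⟨m, hm⟩, 0, fun h => hrm (by rw [show m = 0 from congrArg Subtype.val h, smul_zero])⟩
    · intro W hW
      have hWr : ∀ (a : MonoidAlgebra ℂ G), ∀ w ∈ W, σ.asAlgebraHom a w ∈ W := by
        intro a w hw
        induction a using MonoidAlgebra.induction_on with
        | of g => rw [asAlgebraHom_of]; exact hW g w hw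
        | add a b ha hb => rw [map_add]; exact W.add_mem ha hb
        | smul c a ha => rw [map_smul]; exact W.smul_mem c ha
      let T : Submodule (MonoidAlgebra ℂ G) (MonoidAlgebra ℂ G) :=
        { carrier := Subtype.val '' (W : Set S')
          add_mem' := by
            rintro _ _ ⟨a, ha, rfl⟩ ⟨b, hb, rfl⟩
            exact ⟨a + b, W.add_mem ha hb, rfl⟩
          zero_mem' := ⟨0, W.zero_mem, rfl⟩
          smul_mem' := by
            rintro c _ ⟨a, ha, rfl⟩
            exact ⟨_, hWr c a ha, hσr c a⟩ }
      have hTS : T ≤ S := by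
        rintro _ ⟨a, -, rfl⟩
        exact a.2
      rcases hatom.le_iff.1 hTS with h | h
      · left
        rw [eq_bot_iff]
        intro w hw
        have : (w : MonoidAlgebra ℂ G) ∈ T := ⟨w, hw, rfl⟩
        rw [h] at this
        exact Subtype.ext this
      · right
        rw [eq_top_iff]
        rintro w -
        have : (w : MonoidAlgebra ℂ G) ∈ T := h ▸ w.2
        obtain ⟨a, ha, hav⟩ := this
        rwa [Subtype.ext hav] at ha
  let e := (Module.finBasis ℂ S').equivFun
  refine ⟨_, σ.transport e, hσ.transport e, fun h => hrm ?_⟩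
  have h1 : ∀ r : MonoidAlgebra ℂ G, (σ.transport e).asAlgebraHom r =
      e.conjAlgEquiv ℂ (σ.asAlgebraHom r) := by
    intro r
    induction r using MonoidAlgebra.induction_on with
    | of g => rw [asAlgebraHom_of, asAlgebraHom_of]; rfl
    | add a b ha hb => rw [map_add, map_add, map_add, ha, hb]
    | smul c a ha => rw [map_smul, map_smul, map_smul, ha]
  rw [h1, EmbeddingLike.map_eq_zero_iff] at h
  have h2 := hσr r ⟨m, hm⟩
  rw [h] at h2
  exact h2.symm

/-- A normal subgroup fixing a nonzero vector of an irreducible representation acts trivially. -/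
theorem IsIrreducible.eq_one_of_fixes {ρ : Representation ℂ G V} (h : ρ.IsIrreducible)
    {K : Subgroup G} [K.Normal] {v : V} (hv : v ≠ 0) (hK : ∀ k ∈ K, ρ k v = v) :
    ∀ k ∈ K, ρ k = 1 := by
  rw [isIrreducible_iff_forall_submodule] at h
  let W : Submodule ℂ V :=
    { carrier := {v | ∀ k ∈ K, ρ k v = v}
      add_mem' := fun ha hb k hk => by rw [map_add, ha k hk, hb k hk]
      zero_mem' := fun k _ => map_zero _
      smul_mem' := fun c v hv k hk => by rw [map_smul, hv k hk] }
  have hW : W = ⊤ := by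
    refine (h.2 W fun g w hw k hk => ?_).resolve_left fun hbot => hv ?_
    · have h1 := hw (g⁻¹ * k * g) (by
        have := ‹K.Normal›.conj_mem k hk g⁻¹
        rwa [inv_inv] at this)
      rw [← Module.End.mul_apply, ← map_mul, show k * g = g * (g⁻¹ * k * g) by group, map_mul,
        Module.End.mul_apply, h1]
    · rw [← Submodule.mem_bot ℂ, ← hbot]
      exact hK
  intro k hk
  refine LinearMap.ext fun v => ?_
  have : v ∈ W := hW ▸ Submodule.mem_top
  exact this k hk

theorem apply_sum_subgroup (ρ : Representation ℂ G V) {K : Subgroup G} [Fintype K] {k : G}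
    (hk : k ∈ K) (v : V) : ρ k ((∑ j : K, ρ j) v) = (∑ j : K, ρ j) v := by
  rw [LinearMap.sum_apply, map_sum]
  refine Fintype.sum_equiv (Equiv.mulLeft (⟨k, hk⟩ : K)) _ _ fun j => ?_
  simp [map_mul]

/-- If `K` is a normal subgroup acting nontrivially on an irreducible representation and the
character is constant on `x * K`, then it vanishes at `x`. -/
theorem IsIrreducible.character_eq_zero_of_forall_mul [Finite G] {ρ : Representation ℂ G V}
    (h : ρ.IsIrreducible) {K : Subgroup G} [K.Normal] (hK : ∃ k ∈ K, ρ k ≠ 1) {x : G}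
    (hx : ∀ k ∈ K, ρ.character (x * k) = ρ.character x) : ρ.character x = 0 := by
  have := Fintype.ofFinite K
  -- The image of this sum is fixed by K, so a nonzero value would make K act trivially.
  have hP : (∑ k : K, ρ k) = 0 := by
    refine LinearMap.ext fun v => ?_
    by_contra hv
    obtain ⟨k, hk, hne⟩ := hK
    exact hne (h.eq_one_of_fixes hv (fun k hk => ρ.apply_sum_subgroup hk v) k hk)
  have h1 : ∑ k : K, ρ.character (x * k) = 0 := by
    simp only [character, map_mul, ← map_sum, ← Finset.mul_sum]
    rw [hP, mul_zero, map_zero]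
  rw [Finset.sum_congr rfl fun (k : K) _ => hx k k.2, Finset.sum_const, smul_eq_zero] at h1
  exact h1.resolve_left (by simp)

/-- An element outside a normal subgroup `M` acts nontrivially on some irreducible representation
on which `M` acts trivially. -/
theorem exists_isIrreducible_of_notMem [Finite G] {M : Subgroup G} [M.Normal] {x : G}
    (hx : x ∉ M) : ∃ (n : ℕ) (ρ : Representation ℂ G (Fin n → ℂ)), ρ.IsIrreducible ∧
      (∀ m ∈ M, ρ m = 1) ∧ ρ x ≠ 1 := by
  classical
  have := Fintype.ofFinite M
  -- Where (x - 1)s acts nontrivially, s yields a nonzero M-fixed vector and x is not the identity.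
  -- The product is nonzero because its coefficient at 1 is -1, as x is not in M.
  let s : MonoidAlgebra ℂ G := ∑ m : M, MonoidAlgebra.of ℂ G m
  have hs : (MonoidAlgebra.of ℂ G x - 1) * s ≠ 0 := by
    intro h0
    rw [sub_mul, one_mul, sub_eq_zero] at h0
    have h1 := congrArg (fun r : MonoidAlgebra ℂ G => r.coeff 1) h0
    have hxm : ∀ m : M, x * (m : G) ≠ 1 := fun m hm =>
      hx ((M.mul_mem_cancel_right m.2).1 (hm ▸ M.one_mem))
    have hm1 : ∀ m : M, ((m : G) = 1) = (m = 1) := fun m => propext OneMemClass.coe_eq_one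
    simp only [s, Finset.mul_sum, ← map_mul] at h1
    simp [MonoidAlgebra.of_apply, Finsupp.single_apply, hxm, hm1] at h1
  obtain ⟨n, ρ, hρ, hne⟩ := exists_isIrreducible_asAlgebraHom_ne_zero hs
  have hexp : ρ.asAlgebraHom ((MonoidAlgebra.of ℂ G x - 1) * s) = (ρ x - 1) * ∑ m : M, ρ m := by
    simp only [s, map_mul, map_sub, map_one, map_sum, asAlgebraHom_of]
  rw [hexp] at hne
  refine ⟨n, ρ, hρ, ?_, fun h1 => hne (by rw [h1, sub_self, zero_mul])⟩
  obtain ⟨v, hv⟩ : ∃ v, (∑ m : M, ρ m) v ≠ 0 := by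
    by_contra! hcon
    exact hne (by rw [LinearMap.ext hcon (g := 0), mul_zero])
  exact hρ.eq_one_of_fixes hv fun k hk => ρ.apply_sum_subgroup hk v

/-- Every linear character `u` of a subgroup `F` occurs in some irreducible representation. -/
theorem exists_isIrreducible_of_linearCharacter [Finite G] {F : Subgroup G} (u : F →* ℂˣ) :
    ∃ (n : ℕ) (ρ : Representation ℂ G (Fin n → ℂ)), ρ.IsIrreducible ∧
      ∃ v ≠ 0, ∀ f : F, ρ f v = (u f : ℂ) • v := by
  classical
  have := Fintype.ofFinite F
  -- A multiple of the idempotent of u: its image consists of vectors of weight u, and its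
  -- coefficient at 1 is 1.
  let s : MonoidAlgebra ℂ G := ∑ f : F, ((u f)⁻¹ : ℂˣ).val • MonoidAlgebra.of ℂ G f
  have hs : s ≠ 0 := by
    intro h0
    have h1 := congrArg (fun r : MonoidAlgebra ℂ G => r.coeff 1) h0
    have hm1 : ∀ m : F, ((m : G) = 1) = (m = 1) := fun m => propext OneMemClass.coe_eq_one
    simp [s, MonoidAlgebra.of_apply, Finsupp.single_apply, hm1] at h1
  obtain ⟨n, ρ, hρ, hne⟩ := exists_isIrreducible_asAlgebraHom_ne_zero hs
  obtain ⟨v, hv⟩ : ∃ v, ρ.asAlgebraHom s v ≠ 0 := by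
    by_contra! hcon
    exact hne (LinearMap.ext hcon)
  refine ⟨n, ρ, hρ, _, hv, fun f => ?_⟩
  simp only [s, map_sum, map_smul, asAlgebraHom_of, LinearMap.sum_apply, LinearMap.smul_apply,
    Finset.smul_sum]
  refine Fintype.sum_equiv (Equiv.mulLeft f) _ _ fun j => ?_
  rw [Equiv.coe_mulLeft, Subgroup.coe_mul, map_mul, map_mul, Module.End.mul_apply, smul_smul,
    mul_inv, Units.val_mul, ← mul_assoc, ← Units.val_mul, mul_inv_cancel, Units.val_one, one_mul]

/-- The span of the orbit of a nonzero vector of an irreducible representation is everything. -/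
theorem IsIrreducible.span_orbit_eq_top {ρ : Representation ℂ G V} (h : ρ.IsIrreducible) {v : V}
    (hv : v ≠ 0) : Submodule.span ℂ (Set.range fun y => ρ y v) = ⊤ := by
  rw [isIrreducible_iff_forall_submodule] at h
  refine (h.2 _ fun g w hw => ?_).resolve_left fun hb => hv ?_
  · have : Submodule.span ℂ (Set.range fun y => ρ y v) ≤
        (Submodule.span ℂ (Set.range fun y => ρ y v)).comap (ρ g) := by
      rw [Submodule.span_le]
      rintro _ ⟨y, rfl⟩
      refine Submodule.subset_span ⟨g * y, ?_⟩
      simp [map_mul]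
    exact this hw
  · rw [← Submodule.mem_bot ℂ, ← hb]
    exact Submodule.subset_span ⟨1, by simp⟩

/-- The conjugation action of `G` on the linear characters of a normal subgroup. -/
noncomputable def conjLinearCharacter (F : Subgroup G) [F.Normal] : G →* MulAut (F →* ℂˣ) where
  toFun g :=
    { toFun := fun u => u.comp (MulAut.conjNormal g⁻¹ : MulAut F).toMonoidHom
      invFun := fun u => u.comp (MulAut.conjNormal g : MulAut F).toMonoidHom
      left_inv := fun u => by ext f; simp
      right_inv := fun u => by ext f; simp
      map_mul' := fun u v => rfl }
  map_one' := by ext u f; simp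
  map_mul' a b := by ext u f; simp

theorem conjLinearCharacter_apply (F : Subgroup G) [F.Normal] (g : G) (u : F →* ℂˣ) (f : F) :
    conjLinearCharacter F g u f = u (MulAut.conjNormal g⁻¹ f) := rfl

/-- If no conjugate of `g` fixes the linear character `u` of the normal subgroup `F`, then the
character of an irreducible representation lying over `u` vanishes at `g`. -/
theorem IsIrreducible.character_eq_zero_of_weight [Finite G] {ρ : Representation ℂ G V}
    (h : ρ.IsIrreducible) {F : Subgroup G} [F.Normal] {u : F →* ℂˣ} {v : V} (hv : v ≠ 0)
    (hu : ∀ f : F, ρ f v = (u f : ℂ) • v) {g : G}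
    (hg : ∀ y : G, conjLinearCharacter F (y * g * y⁻¹) u ≠ u) : ρ.character g = 0 := by
  have := Fintype.ofFinite F
  have hweight : ∀ (y : G) (f : F), ρ f (ρ y v) = (conjLinearCharacter F y u f : ℂ) • ρ y v := by
    intro y f
    rw [← Module.End.mul_apply, ← map_mul,
      show (f : G) * y = y * (MulAut.conjNormal y⁻¹ f : F) by
        rw [MulAut.conjNormal_apply]; group,
      map_mul, Module.End.mul_apply, hu, map_smul, conjLinearCharacter_apply]
  -- On ρ(y)v, of weight w, the f-term is (g·w / w)(f) times ρ(gy)v. By `hg` the character g·w / w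
  -- is nontrivial, so its values sum to zero; these vectors span. The trace of the sum is |F|χ(g).
  have hT : (∑ f : F, ρ (f * g * (f : G)⁻¹)) = 0 := by
    refine LinearMap.ext_on_range (v := fun y => ρ y v) (h.span_orbit_eq_top hv) fun y => ?_
    set w := conjLinearCharacter F y u with hw
    have hterm : ∀ f : F, ρ (f * g * (f : G)⁻¹) (ρ y v) =
        ((conjLinearCharacter F g w / w) f : ℂ) • ρ (g * y) v := by
      intro f
      rw [map_mul, map_mul, Module.End.mul_apply, Module.End.mul_apply, ← Subgroup.coe_inv,
        hweight, map_smul, map_smul, ← Module.End.mul_apply (ρ g), ← map_mul, hweight, smul_smul,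
        map_mul, MulAut.mul_apply, ← hw, map_inv, MonoidHom.div_apply]
      congr 1
      rw [mul_comm, div_eq_mul_inv, Units.val_mul]
    rw [LinearMap.sum_apply, Finset.sum_congr rfl fun f _ => hterm f, ← Finset.sum_smul,
      LinearMap.zero_apply]
    have hne : (Units.coeHom ℂ).comp (conjLinearCharacter F g w / w) ≠ 1 := by
      intro h1
      have h2 : conjLinearCharacter F g w = w := by
        rw [← div_eq_one]
        ext f
        exact DFunLike.congr_fun h1 f
      apply hg y⁻¹
      rw [inv_inv, map_mul, map_mul, MulAut.mul_apply, MulAut.mul_apply, ← hw, h2, hw,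
        ← MulAut.mul_apply, ← map_mul, inv_mul_cancel, map_one, MulAut.one_apply]
    have := sum_hom_units_eq_zero _ hne
    simp only [MonoidHom.comp_apply, Units.coeHom_apply] at this
    rw [this, zero_smul]
  have h1 : ∑ f : F, ρ.character (f * g * (f : G)⁻¹) = 0 := by
    simp only [character, ← map_sum]
    rw [hT, map_zero]
  rw [Finset.sum_congr rfl fun (f : F) _ => ρ.char_conj g (f : G), Finset.sum_const, smul_eq_zero] at h1
  exact h1.resolve_left (by simp)

end Representation

/-! ### Monomiality from a series with cyclic factors -/

open TensorProduct in
/-- If an irreducible representation of dimension at least `[G : L]` contains a line stable under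
`L`, then it is induced from the linear representation of `L` on this line. -/
theorem Representation.IsIrreducible.isMonomialCharacter_of_line {G V : Type*} [Group G] [Finite G]
    [AddCommGroup V] [Module ℂ V] [FiniteDimensional ℂ V] {ρ : Representation ℂ G V}
    (h : ρ.IsIrreducible) {L : Subgroup G} (hdim : L.index ≤ Module.finrank ℂ V) {w : V}
    (hw : w ≠ 0) {c : L → ℂ} (hc : ∀ l : L, ρ l w = c l • w) : IsMonomialCharacter ρ.character := by
  let lam : Representation ℂ L ℂ :=
    { toFun := fun l => c l • LinearMap.id
      map_one' := by
        have h1 : c 1 = 1 := smul_left_injective ℂ hw (by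
          change c 1 • w = (1 : ℂ) • w
          rw [← hc]; simp)
        rw [h1, one_smul]; rfl
      map_mul' := fun a b => by
        have h1 : c (a * b) = c a * c b := smul_left_injective ℂ hw (by
          change c (a * b) • w = (c a * c b) • w
          rw [← hc, Subgroup.coe_mul, map_mul, Module.End.mul_apply, hc, map_smul, hc, smul_smul,
            mul_comm])
        rw [h1]
        ext
        simp [mul_comm] }
  have hlam : ∀ l t, lam l t = c l * t := fun l t => rfl
  -- The induced module is the coinvariants for L acting on the group algebra by left translation,
  -- hence the inverse: y ⊗ t goes to tρ(y⁻¹)w.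
  let f : MonoidAlgebra ℂ G ⊗[ℂ] ℂ →ₗ[ℂ] V :=
    TensorProduct.lift ((Finsupp.lift (ℂ →ₗ[ℂ] V) ℂ G fun y =>
      LinearMap.toSpanSingleton ℂ V (ρ y⁻¹ w)) ∘ₗ
        (MonoidAlgebra.coeffLinearEquiv ℂ : MonoidAlgebra ℂ G ≃ₗ[ℂ] (G →₀ ℂ)).toLinearMap)
  have hf : ∀ (y : G) (t : ℂ), f (MonoidAlgebra.single y 1 ⊗ₜ t) = t • ρ y⁻¹ w := by
    intro y t
    simp [f]
  have hfinv : ∀ l : L, f ∘ₗ (Representation.tprod ((leftRegular ℂ G).comp L.subtype) lam) l = f := by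
    intro l
    refine TensorProduct.ext (MonoidAlgebra.lhom_ext' fun y => LinearMap.ext_ring
      (LinearMap.ext_ring ?_))
    have e1 : (Representation.tprod ((leftRegular ℂ G).comp L.subtype) lam) l
        (MonoidAlgebra.single y 1 ⊗ₜ 1) = MonoidAlgebra.single ((l : G) * y) 1 ⊗ₜ (c l) := by
      simp [hlam]
    change f ((Representation.tprod ((leftRegular ℂ G).comp L.subtype) lam) l
        (MonoidAlgebra.single y 1 ⊗ₜ 1)) = f (MonoidAlgebra.single y 1 ⊗ₜ 1)
    rw [e1, hf, hf, one_smul, ← map_smul, ← hc, ← Module.End.mul_apply, ← map_mul, mul_inv_rev,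
      inv_mul_cancel_right]
  let Φ : IndV L.subtype lam →ₗ[ℂ] V := Coinvariants.lift _ f hfinv
  have hΦ : ∀ (y : G) (t : ℂ), Φ (IndV.mk L.subtype lam y t) = t • ρ y⁻¹ w := fun y t => hf y t
  have hinter : ∀ g, Φ ∘ₗ ind L.subtype lam g = ρ g ∘ₗ Φ := by
    intro g
    refine IndV.hom_ext _ _ fun y => LinearMap.ext_ring ?_
    change Φ (ind L.subtype lam g (IndV.mk L.subtype lam y 1)) =
      ρ g (Φ (IndV.mk L.subtype lam y 1))
    rw [ind_mk, hΦ, hΦ, one_smul, one_smul, mul_inv_rev, inv_inv, map_mul, Module.End.mul_apply]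
  have hsurj : Function.Surjective Φ := by
    rw [← LinearMap.range_eq_top, eq_top_iff, ← h.span_orbit_eq_top hw, Submodule.span_le]
    rintro _ ⟨y, rfl⟩
    exact ⟨IndV.mk L.subtype lam y⁻¹ 1, by rw [hΦ, one_smul, inv_inv]⟩
  -- One spanning vector per coset bounds the dimension by [G : L] ≤ dim V, so the surjection `Φ` is
  -- bijective.
  have hspan : Submodule.span ℂ (Set.range fun q : G ⧸ L =>
      IndV.mk L.subtype lam q.out⁻¹ 1) = ⊤ := by
    set S := Submodule.span ℂ (Set.range fun q : G ⧸ L => IndV.mk L.subtype lam q.out⁻¹ 1) with hS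
    have hmk : ∀ y t, IndV.mk L.subtype lam y t ∈ S := by
      intro y t
      obtain ⟨l, hl⟩ := QuotientGroup.mk_out_eq_mul L y⁻¹
      have hy : y = (l : G) * (Quotient.out (QuotientGroup.mk y⁻¹ : G ⧸ L))⁻¹ := by
        rw [hl]; group
      have e1 : IndV.mk L.subtype lam y t =
          IndV.mk L.subtype lam (Quotient.out (QuotientGroup.mk y⁻¹ : G ⧸ L))⁻¹ (lam l⁻¹ t) := by
        have := Coinvariants.mk_self_apply
          (Representation.tprod ((leftRegular ℂ G).comp L.subtype) lam) l
          (MonoidAlgebra.single (Quotient.out (QuotientGroup.mk y⁻¹ : G ⧸ L))⁻¹ 1 ⊗ₜ (lam l⁻¹ t))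
        refine Eq.trans ?_ this
        conv_lhs => rw [hy]
        simp
      rw [e1, show lam l⁻¹ t = (lam l⁻¹ t) • (1 : ℂ) by simp, map_smul]
      exact S.smul_mem _ (Submodule.subset_span ⟨_, rfl⟩)
    have : S.mkQ = 0 := by
      refine IndV.hom_ext _ _ fun y => LinearMap.ext_ring ?_
      change S.mkQ (IndV.mk L.subtype lam y 1) = 0
      rw [Submodule.mkQ_apply, Submodule.Quotient.mk_eq_zero]
      exact hmk y 1
    rw [← S.ker_mkQ, this, LinearMap.ker_zero]
  have := Fintype.ofFinite (G ⧸ L)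
  have hfd : FiniteDimensional ℂ (IndV L.subtype lam) :=
    ⟨⟨(Set.finite_range _).toFinset, by rw [Set.Finite.coe_toFinset]; exact hspan⟩⟩
  have hle : Module.finrank ℂ (IndV L.subtype lam) ≤ Module.finrank ℂ V := by
    refine le_trans ?_ hdim
    rw [← finrank_top, ← hspan, Subgroup.index_eq_card, Nat.card_eq_fintype_card]
    exact finrank_range_le_card _
  have heq : Module.finrank ℂ (IndV L.subtype lam) = Module.finrank ℂ V :=
    le_antisymm hle (LinearMap.finrank_le_finrank_of_surjective hsurj)
  have hinj : Function.Injective Φ :=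
    (LinearMap.injective_iff_surjective_of_finrank_eq_finrank heq).2 hsurj
  exact ⟨L, lam, (char_iso (Equiv.mk (LinearEquiv.ofBijective Φ ⟨hinj, hsurj⟩) hinter)).symm⟩

/-- The finite dimensions of independent subspaces add up to at most the whole dimension. -/
theorem iSupIndep.card_mul_le_finrank {ι V : Type*} [Finite ι] [AddCommGroup V] [Module ℂ V]
    [FiniteDimensional ℂ V] {p : ι → Submodule ℂ V} (hp : iSupIndep p) {d : ℕ}
    (hd : ∀ i, d ≤ Module.finrank ℂ (p i)) : Nat.card ι * d ≤ Module.finrank ℂ V := by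
  classical
  have := Fintype.ofFinite ι
  have h1 := LinearMap.finrank_le_finrank_of_injective
    (f := (DFinsupp.lsum ℕ fun i => (p i).subtype : (DirectSum ι fun i => p i) →ₗ[ℂ] V))
    hp.dfinsupp_lsum_injective
  refine le_trans ?_ ((Module.finrank_directSum (R := ℂ) fun i => p i).symm.le.trans h1)
  rw [Nat.card_eq_fintype_card, ← smul_eq_mul, ← Finset.card_univ]
  exact Finset.card_nsmul_le_sum _ _ _ fun i _ => hd i

namespace Representation

variable {H W : Type*} [Group H] [AddCommGroup W] [Module ℂ W] [FiniteDimensional ℂ W]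

/-- A commuting family of operators has a common eigenvector. -/
theorem exists_common_eigenvector [Nontrivial W] {ι : Type*} (f : ι → Module.End ℂ W)
    (hf : ∀ i j, Commute (f i) (f j)) :
    ∃ χ : ι → ℂ, ⨅ i, (f i).eigenspace (χ i) ≠ ⊥ := by
  -- On a minimal nonzero stable subspace every operator is scalar: its eigenspaces there are stable
  -- under the whole commuting family.
  have hne : {U : Submodule ℂ W | U ≠ ⊥ ∧ ∀ i, ∀ w ∈ U, f i w ∈ U}.Nonempty :=
    ⟨⊤, top_ne_bot, fun _ _ _ => Submodule.mem_top⟩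
  obtain ⟨U, ⟨hU, hUf⟩, hmin⟩ := WellFounded.has_min (wellFounded_lt (α := Submodule ℂ W)) _ hne
  have hU' : Nontrivial U := Submodule.nontrivial_iff_ne_bot.2 hU
  have hscalar : ∀ i, ∃ c : ℂ, U ≤ (f i).eigenspace c := by
    intro i
    obtain ⟨c, hc⟩ := Module.End.exists_eigenvalue ((f i).restrict (hUf i))
    obtain ⟨w, hw⟩ := hc.exists_hasEigenvector
    refine ⟨c, inf_eq_left.1 (eq_of_le_of_not_lt inf_le_left (hmin (U ⊓ (f i).eigenspace c)
      ⟨fun hb => hw.2 ?_, ?_⟩))⟩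
    · have : (w : W) ∈ U ⊓ (f i).eigenspace c :=
        ⟨w.2, Module.End.mem_eigenspace_iff.2 (congrArg Subtype.val hw.apply_eq_smul)⟩
      rw [hb] at this
      exact Subtype.ext this
    · rintro j v ⟨hv1, hv2⟩
      refine ⟨hUf j v hv1, Module.End.mem_eigenspace_iff.2 ?_⟩
      rw [← Module.End.mul_apply, (hf i j).eq, Module.End.mul_apply,
        Module.End.mem_eigenspace_iff.1 hv2, map_smul]
  choose χ hχ using hscalar
  exact ⟨χ, fun hb => hU (eq_bot_iff.2 (hb ▸ le_iInf hχ))⟩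

/-- If a normal subgroup `B` acts on `W` by commuting operators that are not all scalar, then `W`
has a proper nonzero subspace stable under a subgroup of correspondingly small index. -/
theorem exists_stable_subspace_of_commute [Finite H] [Nontrivial W] (σ : Representation ℂ H W)
    {B : Subgroup H} [B.Normal] (hB : ∀ a b : B, Commute (σ a) (σ b))
    (hns : ∃ b ∈ B, ∀ c : ℂ, σ b ≠ c • 1) :
    ∃ (L : Subgroup H) (U : Submodule ℂ W), U ≠ ⊥ ∧ U ≠ ⊤ ∧ (∀ l ∈ L, ∀ u ∈ U, σ l u ∈ U) ∧
      L.index * Module.finrank ℂ U ≤ Module.finrank ℂ W := by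
  obtain ⟨χ, hχ⟩ := exists_common_eigenvector (fun b : B => σ b) hB
  let wt : (B → ℂ) → Submodule ℂ W := fun ψ => ⨅ b : B, Module.End.eigenspace (σ b) (ψ b)
  have hmem : ∀ ψ w, w ∈ wt ψ ↔ ∀ b : B, σ b w = ψ b • w := by
    intro ψ w
    simp only [wt, Submodule.mem_iInf, Module.End.mem_eigenspace_iff]
  have hind : iSupIndep wt :=
    (Module.End.independent_iInf_maxGenEigenspace_of_forall_mapsTo (fun b : B => σ b)
      fun a b φ => Module.End.mapsTo_maxGenEigenspace_of_comm (hB b a) φ).mono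
        fun ψ => iInf_mono fun b => Module.End.genEigenspace_le_maximal _ _ _
  -- The stabilizer of the weight χ. Distinct cosets of L carry distinct weights, whose spaces are
  -- independent and at least as large as that of χ; this gives the index bound.
  let L : Subgroup H :=
    { carrier := {h | ∀ b : B, χ (MulAut.conjNormal h b) = χ b}
      one_mem' := fun b => by simp
      mul_mem' := fun {x y} hx hy b => by
        rw [map_mul, MulAut.mul_apply, hx, hy]
      inv_mem' := fun {x} hx b => by
        have := hx (MulAut.conjNormal x⁻¹ b)
        rw [← MulAut.mul_apply, ← map_mul, mul_inv_cancel, map_one, MulAut.one_apply] at this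
        exact this.symm }
  have hL : ∀ h, h ∈ L ↔ ∀ b : B, χ (MulAut.conjNormal h b) = χ b := fun h => Iff.rfl
  have hmaps : ∀ (h : H) (ψ : B → ℂ), ∀ w ∈ wt ψ,
      σ h w ∈ wt (fun b => ψ (MulAut.conjNormal h⁻¹ b)) := by
    intro h ψ w hw
    rw [hmem] at hw ⊢
    intro b
    rw [← Module.End.mul_apply, ← map_mul, show (b : H) * h = h * (MulAut.conjNormal h⁻¹ b : B) by
      rw [MulAut.conjNormal_apply]; group, map_mul, Module.End.mul_apply, hw, map_smul]
  refine ⟨L, wt χ, hχ, ?_, ?_, ?_⟩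
  · intro htop
    obtain ⟨b, hb, hne⟩ := hns
    refine hne (χ ⟨b, hb⟩) (LinearMap.ext fun w => ?_)
    exact (hmem χ w).1 (htop ▸ Submodule.mem_top) ⟨b, hb⟩
  · intro l hl u hu
    have := hmaps l χ u hu
    rwa [show (fun b => χ (MulAut.conjNormal l⁻¹ b)) = χ from
      funext ((hL _).1 (L.inv_mem hl))] at this
  · let ψ : H ⧸ L → (B → ℂ) := fun q b => χ (MulAut.conjNormal q.out⁻¹ b)
    have hψ : Function.Injective ψ := by
      intro q q' h
      have h1 : q'.out⁻¹ * q.out ∈ L := by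
        rw [hL]
        intro b
        have := congrFun h (MulAut.conjNormal q.out b)
        simp only [ψ, ← MulAut.mul_apply, ← map_mul, inv_mul_cancel, map_one,
          MulAut.one_apply] at this
        exact this.symm
      rw [← QuotientGroup.out_eq' q, ← QuotientGroup.out_eq' q']
      exact (QuotientGroup.eq.2 h1).symm
    rw [Subgroup.index_eq_card]
    refine (hind.comp hψ).card_mul_le_finrank fun q => ?_
    refine LinearMap.finrank_le_finrank_of_injective
      (f := (σ q.out).restrict (hmaps q.out χ)) fun x y hxy => Subtype.ext ?_
    have h1 : σ q.out x = σ q.out y := congrArg Subtype.val hxy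
    have h2 := congrArg (σ q.out⁻¹) h1
    simpa [← Module.End.mul_apply, ← map_mul] using h2

end Representation

/-- An irreducible representation of a finite group `G` having a series of normal subgroups
`M 0, …, M n = G` with `M 0` acting by commuting operators and cyclic factors is monomial. -/
theorem Representation.IsIrreducible.isMonomialCharacter_of_series {G V : Type*} [Group G]
    [Finite G] [AddCommGroup V] [Module ℂ V] [FiniteDimensional ℂ V] {ρ : Representation ℂ G V}
    (h : ρ.IsIrreducible) (M : ℕ → Subgroup G) [∀ i, (M i).Normal]
    (h0 : ∀ a ∈ M 0, ∀ b ∈ M 0, Commute (ρ a) (ρ b)) {n : ℕ} (hn : M n = ⊤)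
    (hcyc : ∀ i < n, IsCyclic ((M (i + 1)).map (QuotientGroup.mk' (M i)))) :
    IsMonomialCharacter ρ.character := by
  have hnt : Nontrivial V := ((isIrreducible_iff_forall_submodule ρ).1 h).1
  -- Start from (G, V) and minimize dim W. By minimality, any normal subgroup of L acting on W by
  -- commuting operators acts by scalars.
  let P : ℕ → Prop := fun d => ∃ (L : Subgroup G) (W : Submodule ℂ V), W ≠ ⊥ ∧
    (∀ l ∈ L, ∀ w ∈ W, ρ l w ∈ W) ∧ L.index * Module.finrank ℂ W ≤ Module.finrank ℂ V ∧
      Module.finrank ℂ W = d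
  have hP : ∃ d, P d := ⟨_, ⊤, ⊤, top_ne_bot, fun _ _ _ _ => Submodule.mem_top, by simp, rfl⟩
  classical
  obtain ⟨L, W, hW, hLW, hle, hd⟩ := Nat.find_spec hP
  have hmin : ∀ (L' : Subgroup G) (W' : Submodule ℂ V), W' ≠ ⊥ →
      (∀ l ∈ L', ∀ w ∈ W', ρ l w ∈ W') →
      L'.index * Module.finrank ℂ W' ≤ Module.finrank ℂ V →
        Module.finrank ℂ W ≤ Module.finrank ℂ W' := by
    intro L' W' h1 h2 h3
    rw [hd]
    exact Nat.find_min' hP ⟨L', W', h1, h2, h3, rfl⟩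
  have hWn : Nontrivial W := Submodule.nontrivial_iff_ne_bot.2 hW
  let σ : Representation ℂ L W :=
    { toFun := fun l => (ρ l).restrict (hLW l l.2)
      map_one' := by ext; simp
      map_mul' := fun a b => by ext; simp }
  have hσ : ∀ (l : L) (w : W), (σ l w : V) = ρ l w := fun l w => rfl
  have key : ∀ B : Subgroup L, B.Normal → (∀ a b : B, Commute (σ a) (σ b)) →
      ∀ b ∈ B, ∃ c : ℂ, σ b = c • 1 := by
    intro B _ hB
    by_contra! hcon
    obtain ⟨L', U, hU, hUt, hL'U, hle'⟩ := exists_stable_subspace_of_commute σ hB hcon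
    have hfr : Module.finrank ℂ (U.map W.subtype) = Module.finrank ℂ U :=
      (Submodule.equivMapOfInjective _ W.injective_subtype U).finrank_eq.symm
    have h1 := hmin (L'.map L.subtype) (U.map W.subtype) ?_ ?_ ?_
    · rw [hfr] at h1
      exact absurd (Submodule.finrank_lt hUt) (not_lt.2 h1)
    · exact fun hb => hU (Submodule.finrank_eq_zero.1 (by rw [← hfr, hb, finrank_bot]))
    · rintro _ ⟨l, hl, rfl⟩ _ ⟨u, hu, rfl⟩
      exact ⟨σ l u, hL'U l hl u hu, rfl⟩
    · rw [hfr, Subgroup.index_map_subtype, mul_right_comm]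
      exact (Nat.mul_le_mul_right _ hle').trans (by rwa [mul_comm])
  have hscalar : ∀ i, i ≤ n → ∀ b : L, (b : G) ∈ M i → ∃ c : ℂ, σ b = c • 1 := by
    intro i
    induction i with
    | zero =>
      intro _ b hb
      exact key ((M 0).subgroupOf L) inferInstance (fun x y => LinearMap.ext fun w => Subtype.ext
        (LinearMap.congr_fun (h0 x x.2 y y.2) (w : V))) b hb
    | succ i ih =>
      intro hi b hb
      have hcyc' : IsCyclic (((M (i + 1) ⊓ L).map (QuotientGroup.mk' (M i)) : Subgroup (G ⧸ M i))) :=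
        have := hcyc i (by omega)
        Subgroup.isCyclic_of_le (Subgroup.map_mono inf_le_left)
      obtain ⟨⟨_, b₀, ⟨hb₀M, hb₀L⟩, rfl⟩, hgen⟩ := hcyc'.exists_generator
      -- Modulo the scalars coming from `M i`, the next term acts through powers of one operator,
      -- hence commutatively, and `key` applies again.
      have hform : ∀ a : (M (i + 1)).subgroupOf L, ∃ (k : ℤ) (c : ℂ),
          σ a = c • σ ((⟨b₀, hb₀L⟩ : L) ^ k) := by
        rintro ⟨a, ha⟩
        obtain ⟨k, hk⟩ := hgen ⟨_, (a : G), ⟨ha, a.2⟩, rfl⟩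
        have hk' : ((b₀ ^ k : G) : G ⧸ M i) = (a : G) := congrArg Subtype.val hk
        obtain ⟨c, hc⟩ := ih (by omega) ((⟨b₀, hb₀L⟩ : L) ^ (-k) * a) (by
          have := QuotientGroup.eq.1 hk'
          simpa using this)
        refine ⟨k, c, ?_⟩
        change σ a = _
        rw [show a = (⟨b₀, hb₀L⟩ : L) ^ k * ((⟨b₀, hb₀L⟩ : L) ^ (-k) * a) by
          rw [zpow_neg, mul_inv_cancel_left], map_mul, hc, mul_smul_comm, mul_one]
      refine key ((M (i + 1)).subgroupOf L) inferInstance (fun x y => ?_) b hb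
      obtain ⟨k, c, hx⟩ := hform x
      obtain ⟨j, d, hy⟩ := hform y
      rw [hx, hy]
      refine Commute.smul_left (Commute.smul_right ?_ d) c
      rw [Commute, SemiconjBy, ← map_mul, ← map_mul, ← zpow_add, ← zpow_add, add_comm]
  have hall : ∀ l : L, ∃ c : ℂ, σ l = c • 1 := fun l => hscalar n le_rfl l (hn ▸ Subgroup.mem_top _)
  choose c hc using hall
  obtain ⟨w, hw⟩ := exists_ne (0 : W)
  refine h.isMonomialCharacter_of_line (L := L) (w := (w : V)) (c := c) ?_
    (fun h0 => hw (Subtype.ext h0)) fun l => ?_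
  · exact (Nat.le_mul_of_pos_right _ Module.finrank_pos).trans hle
  · have := congrArg Subtype.val (LinearMap.congr_fun (hc l) w)
    exact this

/-! ### Commuting conjugates modulo F -/

/-- Conjugation sends a generator of C to some r-th power of it, so it acts on all of C as the r-th
power map. -/
theorem Subgroup.normal_of_le_of_isCyclic {Q : Type*} [Group Q] {C K : Subgroup Q} [C.Normal]
    [hC : IsCyclic C] (hK : K ≤ C) : K.Normal := by
  refine ⟨fun k hk q => ?_⟩
  obtain ⟨⟨c, hc⟩, hgen⟩ := hC.exists_generator
  have hgen' : ∀ x ∈ C, ∃ j : ℤ, c ^ j = x := fun x hx => by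
    obtain ⟨j, hj⟩ := hgen ⟨x, hx⟩
    exact ⟨j, congrArg Subtype.val hj⟩
  obtain ⟨j, rfl⟩ := hgen' k (hK hk)
  obtain ⟨r, hr⟩ := hgen' (q * c * q⁻¹) (Normal.conj_mem inferInstance c hc q)
  rw [← conj_zpow, ← hr, ← zpow_mul, mul_comm, zpow_mul]
  exact K.zpow_mem hk r

/-- Let `C` be a cyclic normal subgroup, and suppose that the coset `x * K` of a nontrivial normal
subgroup `K` is never contained in the conjugacy class of `x`. If `x` commutes modulo `C` with all
its conjugates, then it commutes with them. -/
theorem commute_conj_of_isCyclic {Q : Type*} [Group Q] {C : Subgroup Q} [C.Normal] [hC : IsCyclic C]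
    {x : Q} (hx : ∀ K : Subgroup Q, K.Normal → (∀ k ∈ K, ∃ y, x * k = y * x * y⁻¹) → K = ⊥)
    (hcomm : ∀ t : Q, x⁻¹ * (t * x * t⁻¹) * x * (t * x * t⁻¹)⁻¹ ∈ C) (t : Q) :
    x * (t * x * t⁻¹) = t * x * t⁻¹ * x := by
  have hab : ∀ c ∈ C, ∀ d ∈ C, c * d = d * c := fun c hc d hd =>
    congrArg Subtype.val ((IsCyclic.isMulCommutative (α := C)).is_comm.comm ⟨c, hc⟩ ⟨d, hd⟩)
  have hdiv : ∀ c ∈ C, x⁻¹ * c * x * c⁻¹ ∈ C := fun c hc => C.mul_mem (by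
    have := Subgroup.Normal.conj_mem inferInstance c hc x⁻¹
    rwa [inv_inv] at this) (C.inv_mem hc)
  -- The map c ↦ x⁻¹cxc⁻¹ is a homomorphism into C, and x times its value is cxc⁻¹; so `hx` kills
  -- its image.
  have hcent : ∀ c ∈ C, x * c = c * x := by
    let φ : C →* Q :=
      { toFun := fun c => x⁻¹ * c * x * (c : Q)⁻¹
        map_one' := by simp
        map_mul' := fun c d => by
          have h1 := hab _ (hdiv d d.2) (c : Q)⁻¹ (C.inv_mem c.2)
          calc x⁻¹ * (c * d : Q) * x * (c * d : Q)⁻¹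
              = x⁻¹ * c * x * ((x⁻¹ * d * x * (d : Q)⁻¹) * (c : Q)⁻¹) := by group
            _ = _ := by rw [h1]; group }
    have hle : φ.range ≤ C := by
      rintro _ ⟨c, rfl⟩
      exact hdiv c c.2
    have hbot := hx φ.range (Subgroup.normal_of_le_of_isCyclic hle) (by
      rintro _ ⟨c, rfl⟩
      exact ⟨c, by change x * (x⁻¹ * c * x * (c : Q)⁻¹) = _; group⟩)
    intro c hc
    have h1 : x⁻¹ * c * x * c⁻¹ ∈ φ.range := ⟨⟨c, hc⟩, rfl⟩
    rw [hbot, Subgroup.mem_bot, mul_inv_eq_one, mul_assoc, inv_mul_eq_iff_eq_mul] at h1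
    exact h1.symm
  set y := t * x * t⁻¹ with hy
  have hycent : ∀ c ∈ C, y * c = c * y := by
    intro c hc
    have h1 := hcent (t⁻¹ * c * t) (by
      have := Subgroup.Normal.conj_mem inferInstance c hc t⁻¹
      rwa [inv_inv] at this)
    calc y * c = t * (x * (t⁻¹ * c * t)) * t⁻¹ := by rw [hy]; group
      _ = c * y := by rw [h1, hy]; group
  set z := x⁻¹ * y * x * y⁻¹ with hz
  have hzC : z ∈ C := hcomm t
  have hyz : y * x = x * z * y := by rw [hz]; group
  -- As y centralizes z, conjugating x by powers of y sweeps out the coset x⟨z⟩, so `hx` forces z =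
  -- 1.
  have hpow : ∀ k : ℤ, x * z ^ k = y ^ k * x * (y ^ k)⁻¹ := by
    have hyz' : Commute y z := hycent z hzC
    have hn : ∀ k : ℕ, y ^ k * x = x * z ^ k * y ^ k := by
      intro k
      induction k with
      | zero => simp
      | succ k ih =>
        rw [pow_succ', mul_assoc, ih, mul_assoc x, ← mul_assoc y x, hyz, mul_assoc (x * z),
          ← mul_assoc y (z ^ k), (hyz'.pow_right k).eq, pow_succ' z]
        simp only [mul_assoc]
    intro k
    obtain ⟨k, rfl | rfl⟩ := k.eq_nat_or_neg
    · rw [zpow_natCast, zpow_natCast, hn, mul_inv_cancel_right]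
    · have h2 : Commute (y ^ k) (z ^ k) := hyz'.pow_pow k k
      rw [zpow_neg, zpow_neg, zpow_natCast, zpow_natCast, inv_inv, mul_assoc,
        eq_inv_mul_iff_mul_eq, ← mul_assoc, hn, mul_assoc, h2.inv_right.eq, mul_assoc,
        mul_inv_cancel_left]
  have hbot := hx (Subgroup.zpowers z)
    (Subgroup.normal_of_le_of_isCyclic (Subgroup.zpowers_le.2 hzC)) (by
      rintro _ ⟨k, rfl⟩
      exact ⟨_, hpow k⟩)
  rw [Subgroup.zpowers_eq_bot] at hbot
  rw [hyz, hbot, mul_one]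

/-- A supersolvable quotient `G / F` gives a series of normal subgroups from `F` to `G` with cyclic
factors. -/
theorem IsSupersolvable.exists_series {G : Type*} [Group G] {F : Subgroup G} [F.Normal]
    (h : IsSupersolvable (G ⧸ F)) : ∃ (n : ℕ) (M : ℕ → Subgroup G) (_ : ∀ i, (M i).Normal),
      M 0 = F ∧ M n = ⊤ ∧ (∀ i, F ≤ M i) ∧
        ∀ i < n, IsCyclic ((M (i + 1)).map (QuotientGroup.mk' (M i))) := by
  obtain ⟨n, H, hH, h0, hn, hc⟩ := h
  refine ⟨n, fun i => (H i).comap (QuotientGroup.mk' F), fun i => inferInstance, ?_, ?_, ?_, ?_⟩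
  · simp only [h0, MonoidHom.comap_bot, QuotientGroup.ker_mk']
  · simp only [hn, Subgroup.comap_top]
  · intro i x hx
    rw [Subgroup.mem_comap, QuotientGroup.mk'_apply, (QuotientGroup.eq_one_iff x).2 hx]
    exact one_mem _
  · intro i hi
    obtain ⟨-, hcyc⟩ := hc i hi
    obtain ⟨q, hq⟩ := hcyc.exists_generator
    obtain ⟨⟨a, ha⟩, rfl⟩ := QuotientGroup.mk_surjective q
    obtain ⟨a, rfl⟩ := QuotientGroup.mk'_surjective F a
    refine ⟨⟨⟨_, a, ha, rfl⟩, ?_⟩⟩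
    rintro ⟨_, b, hb, rfl⟩
    obtain ⟨k, hk⟩ := hq (QuotientGroup.mk ⟨QuotientGroup.mk' F b, hb⟩)
    refine ⟨k, Subtype.ext ?_⟩
    have hk' : ((⟨QuotientGroup.mk' F a, ha⟩ ^ k : H (i + 1)) :
        H (i + 1) ⧸ (H i).subgroupOf (H (i + 1))) =
          ((⟨QuotientGroup.mk' F b, hb⟩ : H (i + 1)) : H (i + 1) ⧸ (H i).subgroupOf (H (i + 1))) :=
      (QuotientGroup.mk_zpow _ _ k).trans hk
    rw [QuotientGroup.eq, Subgroup.mem_subgroupOf] at hk'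
    refine QuotientGroup.eq.2 ?_
    change (a ^ k)⁻¹ * b ∈ _
    rw [Subgroup.mem_comap]
    simpa using hk'

/-- If `G / F` is supersolvable, `F ≤ M` and `g` is monomial-non-vanishing, then the image of `g` in
`G / M` is not conjugate to all elements of its coset of a nontrivial normal subgroup. -/
theorem IsMonomialNonVanishing.eq_bot_of_forall_conj {G : Type*} [Group G] [Finite G]
    {F : Subgroup G} [F.Normal] (hsup : IsSupersolvable (G ⧸ F)) {g : G}
    (hg : IsMonomialNonVanishing g) {M : Subgroup G} [M.Normal] (hFM : F ≤ M)
    (K : Subgroup (G ⧸ M)) [K.Normal] (hK : ∀ k ∈ K, ∃ y : G ⧸ M, (g : G ⧸ M) * k = y * g * y⁻¹) :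
    K = ⊥ := by
  by_contra hbot
  obtain ⟨k, hk, hk1⟩ := K.bot_or_exists_ne_one.resolve_left hbot
  obtain ⟨k, rfl⟩ := QuotientGroup.mk'_surjective M k
  -- This representation is trivial on M ≥ F, hence monomial, and nontrivial on the preimage of K,
  -- on whose coset of g its character is constant.
  obtain ⟨d, ρ, hρ, htriv, hne⟩ := Representation.exists_isIrreducible_of_notMem (M := M) (x := k)
    fun h => hk1 ((QuotientGroup.eq_one_iff k).2 h)
  obtain ⟨n, N, hN, hN0, hNn, -, hcyc⟩ := hsup.exists_series
  have hmon : IsMonomialCharacter ρ.character :=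
    hρ.isMonomialCharacter_of_series N (fun a ha b hb => by
      rw [htriv a (hFM (hN0 ▸ ha))]; exact Commute.one_left _) hNn hcyc
  refine hg _ ⟨⟨d, ρ, hρ, rfl⟩, hmon⟩ (hρ.character_eq_zero_of_forall_mul
    (K := K.comap (QuotientGroup.mk' M)) ⟨k, hk, hne⟩ fun j hj => ?_)
  obtain ⟨y, hy⟩ := hK _ hj
  obtain ⟨y, rfl⟩ := QuotientGroup.mk'_surjective M y
  have hmem : (y * g * y⁻¹)⁻¹ * (g * j) ∈ M := QuotientGroup.eq.1 hy.symm
  rw [← ρ.char_conj g y, Representation.character, Representation.character,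
    ← mul_inv_cancel_left (y * g * y⁻¹) (g * j), map_mul, htriv _ hmem, mul_one]

/-- A monomial-non-vanishing element commutes with all its conjugates modulo every normal subgroup
with supersolvable quotient. -/
theorem IsMonomialNonVanishing.commute_conj_quotient {G : Type*} [Group G] [Finite G]
    {F : Subgroup G} [F.Normal] (hsup : IsSupersolvable (G ⧸ F)) {g : G}
    (hg : IsMonomialNonVanishing g) (t : G) :
    ((g * (t * g * t⁻¹) : G) : G ⧸ F) = ((t * g * t⁻¹ * g : G) : G ⧸ F) := by
  obtain ⟨n, M, hM, hM0, hMn, hFM, hcyc⟩ := hsup.exists_series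
  -- The index n - i descends from `M n = ⊤`, where the claim is vacuous, to `M 0 = F`.
  have key : ∀ i ≤ n, ∀ t : G,
      ((g * (t * g * t⁻¹) : G) : G ⧸ M (n - i)) = ((t * g * t⁻¹ * g : G) : G ⧸ M (n - i)) := by
    intro i
    induction i with
    | zero =>
      intro _ t
      rw [Nat.sub_zero, QuotientGroup.eq, hMn]
      exact Subgroup.mem_top _
    | succ i ih =>
      intro hi t
      have hj : n - i = n - (i + 1) + 1 := by omega
      set j := n - (i + 1) with hjdef
      have hC := hcyc j (by omega)
      have : ((M (j + 1)).map (QuotientGroup.mk' (M j))).Normal :=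
        Subgroup.Normal.map inferInstance _ (QuotientGroup.mk'_surjective _)
      refine commute_conj_of_isCyclic (C := (M (j + 1)).map (QuotientGroup.mk' (M j)))
        (x := (g : G ⧸ M j)) (fun K _ hK => hg.eq_bot_of_forall_conj hsup (hFM j) K hK) ?_ t
      intro s
      obtain ⟨s, rfl⟩ := QuotientGroup.mk'_surjective _ s
      refine ⟨g⁻¹ * (s * g * s⁻¹) * g * (s * g * s⁻¹)⁻¹, ?_, rfl⟩
      have h1 := ih (by omega) s
      rw [hj, QuotientGroup.eq] at h1
      have h2 := (hM (j + 1)).conj_mem _ h1 (s * g * s⁻¹)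
      rwa [show s * g * s⁻¹ * ((g * (s * g * s⁻¹))⁻¹ * (s * g * s⁻¹ * g)) * (s * g * s⁻¹)⁻¹ =
        g⁻¹ * (s * g * s⁻¹) * g * (s * g * s⁻¹)⁻¹ by group] at h2
  have h := key n le_rfl t
  rw [Nat.sub_self, QuotientGroup.eq, hM0] at h
  exact QuotientGroup.eq.2 h

/-! ### Action on the dual of a chief factor -/

open commutatorElement in
/-- A nontrivial abelian section `F / D` carries a nontrivial linear character. -/
theorem exists_linearCharacter_ne_one {G : Type*} [Group G] [Finite G] {D F : Subgroup G}
    [D.Normal] (hDF : D < F) (hab : ⁅F, F⁆ ≤ D) :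
    ∃ u : F →* ℂˣ, u ≠ 1 ∧ ∀ f : F, (f : G) ∈ D → u f = 1 := by
  let Q := F ⧸ D.subgroupOf F
  let _ : CommGroup Q :=
    { (inferInstance : Group Q) with
      mul_comm := by
        intro a b
        obtain ⟨a, rfl⟩ := QuotientGroup.mk_surjective a
        obtain ⟨b, rfl⟩ := QuotientGroup.mk_surjective b
        refine QuotientGroup.eq.2 (Subgroup.mem_subgroupOf.2 ?_)
        have := hab (Subgroup.commutator_mem_commutator (F.inv_mem b.2) (F.inv_mem a.2))
        rw [commutatorElement_def] at this
        simpa [mul_assoc] using this }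
  obtain ⟨f, hf, hfD⟩ := SetLike.exists_of_lt hDF
  have hne : (QuotientGroup.mk ⟨f, hf⟩ : Q) ≠ 1 := fun h =>
    hfD (Subgroup.mem_subgroupOf.1 ((QuotientGroup.eq_one_iff _).1 h))
  obtain ⟨φ, hφ⟩ := CommGroup.exists_apply_ne_one_of_hasEnoughRootsOfUnity Q ℂ hne
  refine ⟨φ.comp (QuotientGroup.mk' _), fun h => hφ (DFunLike.congr_fun h ⟨f, hf⟩), fun x hx => ?_⟩
  change φ (QuotientGroup.mk x) = 1
  rw [(QuotientGroup.eq_one_iff x).2 (Subgroup.mem_subgroupOf.2 hx), map_one]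

open commutatorElement in
/-- A monomial-non-vanishing element centralizes every chief factor `F / D` of a finite solvable
group such that `G / F` is supersolvable. -/
theorem IsMonomialNonVanishing.commutator_mem_of_isChiefFactor {G : Type*} [Group G] [Finite G]
    [Group.IsSolvable G] {D F : Subgroup G} [F.Normal] (hsup : IsSupersolvable (G ⧸ F)) {g : G}
    (hg : IsMonomialNonVanishing g) (hD : IsChiefFactor D F) {f : G} (hf : f ∈ F) : ⁅f, g⁆ ∈ D := by
  have hDn := hD.1
  obtain ⟨u₀, hu₀, hu₀D⟩ := exists_linearCharacter_ne_one hD.2.1 hD.commutator_le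
  let φ := Representation.conjLinearCharacter F
  have hφ : ∀ (y : G) (u : F →* ℂˣ) (f : F), φ y u f = u (MulAut.conjNormal y⁻¹ f) :=
    fun _ _ _ => rfl
  have hφF : ∀ y ∈ F, ∀ u, φ y u = u := by
    intro y hy u
    ext f
    rw [hφ, show MulAut.conjNormal y⁻¹ f = (⟨y, hy⟩ : F)⁻¹ * f * (⟨y, hy⟩ : F) from
      Subtype.ext (by simp), map_mul, map_mul, mul_right_comm, ← map_mul,
      inv_mul_cancel, map_one, one_mul]
  let V : Subgroup (F →* ℂˣ) :=
    { carrier := {u | ∀ f : F, (f : G) ∈ D → u f = 1}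
      one_mem' := fun _ _ => rfl
      mul_mem' := fun ha hb f hf => by rw [MonoidHom.mul_apply, ha f hf, hb f hf, one_mul]
      inv_mem' := fun ha f hf => by rw [MonoidHom.inv_apply, ha f hf, inv_one] }
  have hφD : ∀ y : G, ∀ f : F, (f : G) ∈ D → ((MulAut.conjNormal y⁻¹ f : F) : G) ∈ D := by
    intro y f hf
    rw [MulAut.conjNormal_apply]
    exact hDn.conj_mem _ hf _
  have hconj : ∀ y : G, ∀ e ∈ Set.range (fun t : G => t * g * t⁻¹),
      y * e * y⁻¹ ∈ Set.range (fun t : G => t * g * t⁻¹) := by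
    rintro y _ ⟨t, rfl⟩
    exact ⟨y * t, by group⟩
  have hcomm : ∀ e ∈ Set.range (fun t : G => t * g * t⁻¹),
      ∀ e' ∈ Set.range (fun t : G => t * g * t⁻¹), ∀ u, φ e (φ e' u) = φ e' (φ e u) := by
    rintro _ ⟨s, rfl⟩ _ ⟨t, rfl⟩ u
    -- Two conjugates of g commute up to an element of F, and F acts trivially on its own linear
    -- characters.
    have h1 := ‹F.Normal›.conj_mem _
      (QuotientGroup.eq.1 (hg.commute_conj_quotient hsup (s⁻¹ * t))) s
    have h2 : t * g * t⁻¹ * (s * g * s⁻¹) = s * g * s⁻¹ * (t * g * t⁻¹) *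
        (s * ((g * (s⁻¹ * t * g * (s⁻¹ * t)⁻¹))⁻¹ * (s⁻¹ * t * g * (s⁻¹ * t)⁻¹ * g)) * s⁻¹) := by
      group
    generalize s * ((g * (s⁻¹ * t * g * (s⁻¹ * t)⁻¹))⁻¹ * (s⁻¹ * t * g * (s⁻¹ * t)⁻¹ * g)) * s⁻¹ = c
      at h1 h2
    change φ (s * g * s⁻¹) (φ (t * g * t⁻¹) u) = φ (t * g * t⁻¹) (φ (s * g * s⁻¹) u)
    rw [← MulAut.mul_apply, ← MulAut.mul_apply, ← map_mul, ← map_mul, h2, map_mul φ _ c,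
      MulAut.mul_apply, hφF _ h1]
  obtain ⟨u, huV, J, hJV, hJ1, hJ, hfix⟩ := exists_fixing_imp_fixing_subgroup φ
    (Set.range fun t : G => t * g * t⁻¹) hconj hcomm V
    (fun y v hv f hf => hv _ (hφD y f hf)) (fun h => hu₀ (by
      have : u₀ ∈ V := hu₀D
      rwa [h] at this))
  -- `g` has a conjugate fixing `u`
  obtain ⟨n, ρ, hρ, v, hv, hρu⟩ := Representation.exists_isIrreducible_of_linearCharacter u
  obtain ⟨y, hy⟩ : ∃ y : G, φ (y * g * y⁻¹) u = u := by
    by_contra! hcon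
    obtain ⟨n, N, hN, hN0, hNn, -, hcyc⟩ := hsup.exists_series
    refine hg _ ⟨⟨_, ρ, hρ, rfl⟩, hρ.isMonomialCharacter_of_series N ?_ hNn hcyc⟩
      (hρ.character_eq_zero_of_weight hv hρu hcon)
    rw [hN0]
    intro a ha b hb
    -- The normal subgroup [F, F] lies in the kernel of u, so it fixes v and acts trivially; thus F
    -- acts by commuting operators.
    have htriv := hρ.eq_one_of_fixes (K := ⁅F, F⁆) hv (by
      have hle : ⁅F, F⁆ ≤ u.ker.map F.subtype := by
        rw [Subgroup.commutator_le]
        intro a ha b hb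
        refine ⟨⁅(⟨a, ha⟩ : F), (⟨b, hb⟩ : F)⁆, ?_, rfl⟩
        change u _ = 1
        rw [map_commutatorElement, commutatorElement_eq_one_iff_mul_comm, mul_comm]
      intro k hk
      obtain ⟨f, hf, rfl⟩ := hle hk
      rw [Subgroup.coe_subtype, hρu, show u f = 1 from hf, Units.val_one, one_smul])
    have h1 := htriv _ (Subgroup.commutator_mem_commutator ha hb)
    rw [Commute, SemiconjBy, ← map_mul, ← map_mul,
      show a * b = ⁅a, b⁆ * (b * a) by rw [commutatorElement_def]; group, map_mul, h1, one_mul]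
  have hgJ : ∀ j ∈ J, φ g j = j := by
    intro j hj
    have h1 := hfix _ ⟨y, rfl⟩ hy (φ y j) (hJ y j hj)
    rw [← MulAut.mul_apply, ← map_mul, inv_mul_cancel_right, map_mul, MulAut.mul_apply] at h1
    exact (φ y).injective h1
  -- the annihilator of `J` in `F` is `D`
  let E : Subgroup G := (⨅ j : J, (j : F →* ℂˣ).ker).map F.subtype
  have hE : ∀ x : F, (x : G) ∈ E ↔ ∀ j ∈ J, j x = 1 := by
    intro x
    change F.subtype x ∈ E ↔ _
    rw [Subgroup.mem_map_iff_mem F.subtype_injective, Subgroup.mem_iInf]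
    exact ⟨fun h j hj => h ⟨j, hj⟩, fun h j => h j j.2⟩
  have hEF : E ≤ F := Subgroup.map_subtype_le _
  have hED : E = D := by
    -- The annihilator is normal because J is G-invariant; were it all of F, J would be trivial.
    refine (hD.2.2 E ⟨fun x hx y => ?_⟩ (fun x hx => ?_) hEF).resolve_right fun h => hJ1 ?_
    · have h1 := (hE ⟨x, hEF hx⟩).1 hx
      have h2 := (hE (MulAut.conjNormal y ⟨x, hEF hx⟩)).2 fun j hj => by
        have := h1 _ (hJ y⁻¹ j hj)
        rwa [hφ, inv_inv] at this
      rwa [MulAut.conjNormal_apply] at h2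
    · exact (hE ⟨x, hD.2.1.le hx⟩).2 fun j hj => hJV hj _ hx
    · rw [eq_bot_iff]
      intro j hj
      refine MonoidHom.ext fun x => ?_
      exact (hE x).1 (by rw [h]; exact x.2) j hj
  rw [← hED]
  have h1 : ((⟨f, hf⟩ * (MulAut.conjNormal g ⟨f, hf⟩)⁻¹ : F) : G) ∈ E := by
    rw [hE]
    intro j hj
    -- Evaluating the fixed character at gfg⁻¹ gives j(f) = j(gfg⁻¹), and [f, g] = f(gfg⁻¹)⁻¹.
    have h2 := DFunLike.congr_fun (hgJ j hj) (MulAut.conjNormal g ⟨f, hf⟩)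
    rw [hφ, ← MulAut.mul_apply, ← map_mul, inv_mul_cancel, map_one, MulAut.one_apply] at h2
    rw [map_mul, map_inv, h2, mul_inv_cancel]
  rw [commutatorElement_def]
  simpa [MulAut.conjNormal_apply, mul_assoc] using h1

theorem mainTheorem6 (G : Type*) [Group G] [Finite G] (hG : Group.IsSolvable G)
    (hsup : IsSupersolvable (G ⧸ fittingSubgroup G)) (g : G)
    (hg : IsMonomialNonVanishing g) : g ∈ fittingSubgroup G :=
  mem_fittingSubgroup_of_centralizes_isChiefFactor fun _ hD _ hf =>
    hg.commutator_mem_of_isChiefFactor hsup hD hf
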